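/- Let $N,j$ be integers with $1\le j\le N-1$. Let $G_{j+1}\mathbb R^{N+1}$ be the Grassmannian of unoriented $(j+1)$-planes through the origin of $\mathbb R^{N+1}$, $\mu_{j+1}$ its rotationally invariant Borel probability measure (the image of the Haar probability measure of $O(N+1)$), and $\pi_p$ the orthogonal projection of $\mathbb R^{N+1}$ onto $p\in G_{j+1}\mathbb R^{N+1}$. For $x\in\mathbb S^N$ not orthogonal to $p$ let $\psi_p(x)=\pi_p(x)/|\pi_p(x)|$ be the nearest point to $x$ on the $j$-sphere $\mathbb S^j_p=\mathbb S^N\cap p$, and let $\widetilde\psi_p([x])=[\psi_p(x)]$ be the corresponding projection of $\mathbb{RP}^N=\mathbb S^N/\{\pm1\}$ onto the projective $j$-space $\mathbb{RP}^j_p$ of $p$. Here $\mathbb S^N$ carries its geodesic (angle) distance $d$, and $\mathbb{RP}^N$ the distance $\min\{d(x,y),d(x,-y)\}$. A polygonal curve in $\mathbb S^N$ (resp. $\mathbb{RP}^N$) is a curve $\gamma$ on an interval $[a,b]$, $a<b$, made of finitely many consecutive arcs of great circles (resp. images in $\mathbb{RP}^N$ of such arcs), each parametrized with constant positive speed. Its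 length $\mathcal L(\gamma)$ is taken with respect to the above distance. Its geodesic rotation $\mathbf K_g(\gamma)$ is the sum of the turning angles (the angles in $[0,\pi]$ between the left and the right tangent vectors) at the interior parameters; in $\mathbb{RP}^N$ turning angles are computed on a continuous lift to $\mathbb S^N$. If $\gamma$ is regarded as a closed curve ($\gamma(a)=\gamma(b)$), the turning angle at the base point is added. The total curvature $\mathrm{TC}$ of a curve in $\mathbb S^N\subset\mathbb R^{N+1}$ is the supremum, over the polygonal curves of $\mathbb R^{N+1}$ inscribed in it (closed inscribed polygonal curves, for a curve regarded as closed), of the sum of the angles between consecutive oriented segments; for polygonal curves $\gamma$ in $\mathbb{RP}^N$, and for their projections, it is $\mathrm{TC}(\gamma)=\mathcal L(\gamma)+\mathbf K_g(\gamma)$. (a) Let $\gamma$ be a polygonal curve in $\mathbb S^N$. Then for $\mu_{j+1}$-a.e. $p$ no point of $\gamma$ is orthogonal to $p$, so that the projected curve $\psi_p(\gamma)$ is well defined; the quantities below are finite, the integrands are $\mu_{j+1}$-measurable, and $$\mathcal L(\gamma)=\int_{G_{j+1}\mathbb R^{N+1}}\mathcal L(\psi_p(\gamma))\,d\mu_{j+1}(p),\qquad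 \mathbf K_g(\gamma)=\int_{G_{j+1}\mathbb R^{N+1}}\mathbf K_g(\psi_p(\gamma))\,d\mu_{j+1}(p),$$ $$\mathrm{TC}(\gamma)=\int_{G_{j+1}\mathbb R^{N+1}}\mathrm{TC}(\psi_p(\gamma))\,d\mu_{j+1}(p).$$ If $\gamma(a)=\gamma(b)$, the formulas for $\mathbf K_g$ and $\mathrm{TC}$ also hold when $\gamma$ and $\psi_p(\gamma)$ are regarded as closed curves. (b) Let $\gamma$ be a polygonal curve in $\mathbb{RP}^N$. Then for $\mu_{j+1}$-a.e. $p$ no point of $\gamma$ is orthogonal to $p$; the quantities below are finite, the integrands are $\mu_{j+1}$-measurable, and $$\mathcal L(\gamma)=\int_{G_{j+1}\mathbb R^{N+1}}\mathcal L(\widetilde\psi_p(\gamma))\,d\mu_{j+1}(p),\qquad \mathbf K_g(\gamma)=\int_{G_{j+1}\mathbb R^{N+1}}\mathbf K_g(\widetilde\psi_p(\gamma))\,d\mu_{j+1}(p),$$ $$\mathrm{TC}(\gamma)=\int_{G_{j+1}\mathbb R^{N+1}}\mathrm{TC}(\widetilde\psi_p(\gamma))\,d\mu_{j+1}(p).$$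 If $\gamma(a)=\gamma(b)$, the formulas for $\mathbf K_g$ and $\mathrm{TC}$ also hold when $\gamma$ and $\widetilde\psi_p(\gamma)$ are regarded as closed curves. -/

import Mathlib

open MeasureTheory Set
open scoped ENNReal RealInnerProductSpace LinearAlgebra.Projectivization

noncomputable section

namespace PolyAvg

/-- The Euclidean space `ℝ^(N+1)`; the sphere `S^N` is its set of unit vectors. -/
abbrev Euc (N : ℕ) : Type := EuclideanSpace ℝ (Fin (N + 1))

/-! ### The Grassmannian and its invariant probability measure -/

/-- The orthogonal group `O(N+1)`, with the topology of the operator norm. -/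
abbrev OrthGroup (N : ℕ) : Type := unitary (Euc N →L[ℝ] Euc N)

/-- The Grassmannian of unoriented `k`-planes (through the origin) in `ℝ^(N+1)`. -/
def Gr (N k : ℕ) : Type := {p : Submodule ℝ (Euc N) // Module.finrank ℝ p = k}

namespace Gr

/-- The orthogonal projection `π_p` of `ℝ^(N+1)` onto `p`. -/
def proj {N k : ℕ} (p : Gr N k) : Euc N →L[ℝ] Euc N := p.1.starProjection

/-- The usual topology of the Grassmannian: planes are close when the orthogonal projections
onto them are close. -/
instance (N k : ℕ) : TopologicalSpace (Gr N k) := TopologicalSpace.induced proj inferInstance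

/-- The Borel σ-algebra of the Grassmannian. -/
instance (N k : ℕ) : MeasurableSpace (Gr N k) := borel _

instance (N k : ℕ) : BorelSpace (Gr N k) := ⟨rfl⟩

/-- The image `g p` of a plane `p` under an orthogonal transformation `g`. -/
def rotate {N k : ℕ} (g : OrthGroup N) (p : Gr N k) : Gr N k :=
  ⟨p.1.map (Unitary.linearIsometryEquiv g).toLinearEquiv.toLinearMap, by
    rw [LinearEquiv.finrank_map_eq]; exact p.2⟩

/-- The coordinate `k`-plane spanned by the first `k` vectors of the standard basis. -/
def coordPlane (N k : ℕ) (h : k ≤ N + 1) : Gr N k :=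
  ⟨Submodule.span ℝ (range fun i : Fin k => EuclideanSpace.basisFun (Fin (N + 1)) ℝ (Fin.castLE h i)),
    by
      rw [finrank_span_eq_card]
      · simp
      · exact (EuclideanSpace.basisFun (Fin (N + 1)) ℝ).orthonormal.linearIndependent.comp _
          (Fin.castLE_injective h)⟩

end Gr

theorem continuousStar_clm (E : Type*) [NormedAddCommGroup E] [InnerProductSpace ℝ E]
    [CompleteSpace E] : ContinuousStar (E →L[ℝ] E) := inferInstance

instance (N : ℕ) : ContinuousStar (Euc N →L[ℝ] Euc N) := continuousStar_clm (Euc N)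

instance (N : ℕ) : CompactSpace (OrthGroup N) := by
  apply isCompact_iff_compactSpace.mp
  refine Metric.isCompact_of_isClosed_isBounded ?_ ?_
  · exact isClosed_unitary
  · refine (Metric.isBounded_closedBall (x := (0 : Euc N →L[ℝ] Euc N)) (r := 1)).subset ?_
    intro u hu
    rw [mem_closedBall_zero_iff]
    refine ContinuousLinearMap.opNorm_le_bound _ zero_le_one fun x => ?_
    have := (Unitary.linearIsometryEquiv (⟨u, hu⟩ : OrthGroup N)).norm_map x
    rw [one_mul]
    exact this.le

/-- The Haar probability measure of the compact group `O(N+1)`. -/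
def haarO (N : ℕ) : Measure (OrthGroup N) := Measure.haarMeasure ⊤

/-- The rotationally invariant probability measure `μ_k` of the Grassmannian of `k`-planes in
`ℝ^(N+1)`: the law of `g p₀`, for `p₀` a fixed `k`-plane and `g` a Haar distributed element of
`O(N+1)`. -/
def grMeasure (N k : ℕ) (h : k ≤ N + 1) : Measure (Gr N k) :=
  (haarO N).map fun g => Gr.rotate g (Gr.coordPlane N k h)

theorem Gr.proj_rotate {N k : ℕ} (g : OrthGroup N) (p : Gr N k) :
    (Gr.rotate g p).proj = (g : Euc N →L[ℝ] Euc N) * p.proj * star (g : Euc N →L[ℝ] Euc N) := by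
  ext1 x
  have := Submodule.starProjection_map_apply (Unitary.linearIsometryEquiv g) p.1 x
  exact this

theorem Gr.continuous_rotate_left {N k : ℕ} (p : Gr N k) :
    Continuous fun g : OrthGroup N => Gr.rotate g p := by
  refine continuous_induced_rng.2 ?_
  have : (Gr.proj ∘ fun g : OrthGroup N => Gr.rotate g p) = fun g : OrthGroup N =>
      (g : Euc N →L[ℝ] Euc N) * p.proj * star (g : Euc N →L[ℝ] Euc N) :=
    funext fun g => Gr.proj_rotate g p
  rw [this]
  fun_prop

theorem Gr.continuous_rotate {N k : ℕ} (g : OrthGroup N) :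
    Continuous fun p : Gr N k => Gr.rotate g p := by
  refine continuous_induced_rng.2 ?_
  have : (Gr.proj ∘ fun p : Gr N k => Gr.rotate g p) = fun p : Gr N k =>
      (g : Euc N →L[ℝ] Euc N) * p.proj * star (g : Euc N →L[ℝ] Euc N) :=
    funext fun p => Gr.proj_rotate g p
  rw [this]
  have : Continuous (Gr.proj : Gr N k → _) := continuous_induced_dom
  fun_prop

instance (N k : ℕ) (h : k ≤ N + 1) : IsProbabilityMeasure (grMeasure N k h) := by
  have : IsProbabilityMeasure (haarO N) := ⟨by
    have := Measure.haarMeasure_self (K₀ := (⊤ : TopologicalSpace.PositiveCompacts (OrthGroup N)))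
    simpa [haarO] using this⟩
  exact Measure.isProbabilityMeasure_map (Gr.continuous_rotate_left _).measurable.aemeasurable

/-- `μ_k` is rotationally invariant. -/
theorem grMeasure_map_rotate (N k : ℕ) (h : k ≤ N + 1) (g : OrthGroup N) :
    (grMeasure N k h).map (Gr.rotate g) = grMeasure N k h := by
  have hinv : (haarO N).map (fun g' => g * g') = haarO N := by
    unfold haarO
    exact map_mul_left_eq_self _ g
  unfold grMeasure
  rw [Measure.map_map (Gr.continuous_rotate g).measurable (Gr.continuous_rotate_left _).measurable]
  conv_rhs => rw [← hinv]
  rw [Measure.map_map (Gr.continuous_rotate_left _).measurable (by fun_prop)]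
  congr 1
  funext g'
  refine Subtype.ext ?_
  simp only [Function.comp, Gr.rotate, map_mul]
  rw [← Submodule.map_comp]
  rfl

/-! ### Length of a curve -/

/-- The length on `[a,b]` of a curve `γ` in a space with distance function `d`: the supremum of
`∑ d(γ(u i), γ(u (i+1)))` over all finite monotone sequences `u` in `[a,b]`. -/
def curveLength {X : Type*} (d : X → X → ℝ) (γ : ℝ → X) (a b : ℝ) : ℝ≥0∞ :=
  ⨆ (n : ℕ) (u : ℕ → ℝ) (_ : Monotone u) (_ : ∀ i, u i ∈ Icc a b),
    ∑ i ∈ Finset.range n, ENNReal.ofReal (d (γ (u i)) (γ (u (i + 1))))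

/-! ### Curves in the sphere -/

/-- `γ`, on `[a,b]`, is a polygonal curve in the sphere `S^N`: for some partition
`a = t₀ < t₁ < ⋯ < t_m = b` each `γ|[tᵢ, tᵢ₊₁]` runs along an arc of a great circle
with constant positive speed. -/
def IsSpherePolygonal {N : ℕ} (γ : ℝ → Euc N) (a b : ℝ) : Prop :=
  a < b ∧ ∃ (m : ℕ) (t : ℕ → ℝ), t 0 = a ∧ t m = b ∧ ∀ i < m, t i < t (i + 1) ∧
    ∃ (v w : Euc N) (c : ℝ), ‖v‖ = 1 ∧ ‖w‖ = 1 ∧ ⟪v, w⟫ = 0 ∧ 0 < c ∧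
      ∀ s ∈ Icc (t i) (t (i + 1)),
        γ s = Real.cos (c * (s - t i)) • v + Real.sin (c * (s - t i)) • w

/-- The length of a curve in `S^N`, for the geodesic distance of the sphere, which is the angle
between unit vectors. -/
def sphereLength {N : ℕ} (γ : ℝ → Euc N) (a b : ℝ) : ℝ≥0∞ :=
  curveLength InnerProductGeometry.angle γ a b

/-- The turning angle of a curve at an interior parameter `s`: the angle between its left and its
right tangent vectors. -/
def turningAngle {N : ℕ} (γ : ℝ → Euc N) (s : ℝ) : ℝ :=
  InnerProductGeometry.angle (derivWithin γ (Iic s) s) (derivWithin γ (Ici s) s)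

/-- The geodesic rotation of a curve in `S^N` on `[a,b]`: the sum of its turning angles. For a
polygonal curve the turning angle vanishes except at vertices. -/
def rotation {N : ℕ} (γ : ℝ → Euc N) (a b : ℝ) : ℝ≥0∞ :=
  ∑' s : Ioo a b, ENNReal.ofReal (turningAngle γ s)

/-- The turning angle at the base point of a closed curve, that is, when `γ a = γ b`. The factor
`⟪γ a, γ b⟫` is then `1`; it allows for the lifts to `S^N` of closed curves in `RP^N`, for which
`γ b = γ a` or `γ b = -γ a`: in the latter case the lift is continued by `-γ`. -/
def closingAngle {N : ℕ} (γ : ℝ → Euc N) (a b : ℝ) : ℝ :=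
  InnerProductGeometry.angle (derivWithin γ (Iic b) b) (⟪γ a, γ b⟫ • derivWithin γ (Ici a) a)

/-- The geodesic rotation of a closed curve: the turning angle at the base point counts too. -/
def closedRotation {N : ℕ} (γ : ℝ → Euc N) (a b : ℝ) : ℝ≥0∞ :=
  rotation γ a b + ENNReal.ofReal (closingAngle γ a b)

/-- The total curvature of a curve in `ℝ^(N+1)`: the supremum, over the inscribed polygonal curves
with (non-trivial) segments from `γ(u i)` to `γ(u (i+1))`, `i = 0, …, n`, of the sum of the angles
between consecutive segments. -/
def totalCurvature {N : ℕ} (γ : ℝ → Euc N) (a b : ℝ) : ℝ≥0∞ :=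
  ⨆ (n : ℕ) (u : ℕ → ℝ) (_ : StrictMono u) (_ : ∀ i ≤ n + 1, u i ∈ Icc a b)
    (_ : ∀ i ≤ n, γ (u i) ≠ γ (u (i + 1))),
    ∑ i ∈ Finset.range n, ENNReal.ofReal (InnerProductGeometry.angle
      (γ (u (i + 1)) - γ (u i)) (γ (u (i + 2)) - γ (u (i + 1))))

/-- The total curvature of a closed curve in `ℝ^(N+1)`: the inscribed polygonal curves are closed,
with `n + 2` vertices; the indices are cyclic, as addition in `Fin (n + 2)` is modulo `n + 2`. -/
def closedTotalCurvature {N : ℕ} (γ : ℝ → Euc N) (a b : ℝ) : ℝ≥0∞ :=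
  ⨆ (n : ℕ) (u : Fin (n + 2) → ℝ) (_ : StrictMono u) (_ : ∀ i, u i ∈ Ico a b)
    (_ : ∀ i, γ (u i) ≠ γ (u (i + 1))),
    ∑ i, ENNReal.ofReal (InnerProductGeometry.angle
      (γ (u (i + 1)) - γ (u i)) (γ (u (i + 1 + 1)) - γ (u (i + 1))))

/-- The nearest-point projection `ψ_p(x) = π_p(x) / |π_p(x)|` of `x ∈ S^N` onto the sphere
`S^N ∩ p`, for `x` not orthogonal to `p` (otherwise the value is `0`). -/
def sphereProj {N k : ℕ} (p : Gr N k) (x : Euc N) : Euc N := ‖p.proj x‖⁻¹ • p.proj x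

/-! ### Curves in the projective space -/

/-- The real projective space `RP^N`. -/
abbrev RP (N : ℕ) : Type := ℙ ℝ (Euc N)

/-- The distance `d([x],[y]) = min (d(x,y), d(x,-y))` of `RP^N`, with `d` the geodesic distance of
the sphere. (The angle does not change when vectors are rescaled by positive factors.) -/
def rpDist {N : ℕ} (x y : RP N) : ℝ :=
  min (InnerProductGeometry.angle x.rep y.rep) (InnerProductGeometry.angle x.rep (-y.rep))

/-- `γ`, on `[a,b]`, is a polygonal curve in `RP^N`: for some partition
`a = t₀ < t₁ < ⋯ < t_m = b` each `γ|[tᵢ, tᵢ₊₁]` runs with constant positive speed along a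
geodesic arc of `RP^N`, that is, the image of an arc of a great circle. -/
def IsRPPolygonal {N : ℕ} (γ : ℝ → RP N) (a b : ℝ) : Prop :=
  a < b ∧ ∃ (m : ℕ) (t : ℕ → ℝ), t 0 = a ∧ t m = b ∧ ∀ i < m, t i < t (i + 1) ∧
    ∃ (v w : Euc N) (c : ℝ), ‖v‖ = 1 ∧ ‖w‖ = 1 ∧ ⟪v, w⟫ = 0 ∧ 0 < c ∧
      ∀ s ∈ Icc (t i) (t (i + 1)),
        ∃ h : Real.cos (c * (s - t i)) • v + Real.sin (c * (s - t i)) • w ≠ 0,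
          γ s = Projectivization.mk ℝ _ h

/-- The length of a curve in `RP^N`. -/
def rpLength {N : ℕ} (γ : ℝ → RP N) (a b : ℝ) : ℝ≥0∞ := curveLength rpDist γ a b

/-- `η` is, on `[a,b]`, a continuous lift to `S^N` of the curve `γ` in `RP^N`. -/
def IsLift {N : ℕ} (γ : ℝ → RP N) (η : ℝ → Euc N) (a b : ℝ) : Prop :=
  ContinuousOn η (Icc a b) ∧
    ∀ s ∈ Icc a b, ‖η s‖ = 1 ∧ ∃ h : η s ≠ 0, Projectivization.mk ℝ (η s) h = γ s

/-- The geodesic rotation of a curve in `RP^N`. The turning angles are those of a continuous lift;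
there are exactly two lifts `η` and `-η`, which have the same turning angles. -/
def rpRotation {N : ℕ} (γ : ℝ → RP N) (a b : ℝ) : ℝ≥0∞ :=
  ⨅ (η : ℝ → Euc N) (_ : IsLift γ η a b), rotation η a b

/-- The geodesic rotation of a closed curve in `RP^N`, with the turning angle at the base point. -/
def rpClosedRotation {N : ℕ} (γ : ℝ → RP N) (a b : ℝ) : ℝ≥0∞ :=
  ⨅ (η : ℝ → Euc N) (_ : IsLift γ η a b), closedRotation η a b

/-- The total curvature of a polygonal curve in `RP^N`: the sum of its length (the curvature of
the geodesic arcs) and of its geodesic rotation (the turning angles between them). -/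
def rpTotalCurvature {N : ℕ} (γ : ℝ → RP N) (a b : ℝ) : ℝ≥0∞ :=
  rpLength γ a b + rpRotation γ a b

/-- The total curvature of a closed polygonal curve in `RP^N`. -/
def rpClosedTotalCurvature {N : ℕ} (γ : ℝ → RP N) (a b : ℝ) : ℝ≥0∞ :=
  rpLength γ a b + rpClosedRotation γ a b

open Classical in
/-- The nearest-point projection `[x] ↦ [ψ_p(x)] = [π_p(x)]` of `RP^N` onto the projective space of
`p`, for `x` not orthogonal to `p` (otherwise the value is immaterial: the point `[x]` itself). -/
def rpProj {N k : ℕ} (p : Gr N k) (x : RP N) : RP N :=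
  if h : p.proj x.rep ≠ 0 then Projectivization.mk ℝ (p.proj x.rep) h else x

/-! ### Averages -/

/-- The quantity `q` is finite, and it is the average (with respect to `μ`) of the measurable
function `F`. -/
def IsAverage {Ω : Type*} [MeasurableSpace Ω] (μ : Measure Ω) (q : ℝ≥0∞) (F : Ω → ℝ≥0∞) : Prop :=
  q ≠ ∞ ∧ AEMeasurable F μ ∧ q = ∫⁻ p, F p ∂μ

end PolyAvg

end

noncomputable section
namespace PolyAvg

open InnerProductGeometry

/-! Everything reduces to one averaging fact (`meanAngle_eq_angle`): if `y`, `z` are nonzero and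
orthogonal to `x`, then the mean over random planes `p` of the angle between `tang p.proj x y` and
`tang p.proj x z` is the angle between `y` and `z`. The case `x = 0` is the length of an arc shorter
than `π`, which is the angle between its endpoints. The case of a unit vector `x` is the turning
angle at a vertex `x`, because `tang` is, up to a positive factor, the differential of the
nearest-point projection.

The averaging fact holds because, in a plane orthogonal to `x`, the mean angle depends only on the
angle between two directions: the law of `p` is invariant under reflections fixing `x`. It is
moreover additive, since a linear map that does not kill the middle direction preserves betweenness
(`meanAngle_add`). An additive bounded function on `[0, π]` with value `π` at `π` is the identity
(`meanAngle_circ`). This requires that a given direction is almost never killed (`ae_tang_ne_zero`),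
which uses that `p` has dimension at least two.

Almost every projection maps an arc shorter than `π` to another such arc (`ArcData.proj`), with
non-constant speed in general; hence arcs are allowed an arbitrary positive speed. Length and
rotation add along chains of arcs, so their averages follow arc by arc and vertex by vertex.

Total curvature is length plus rotation for every chain of arcs in the sphere
(`ArcChain.totalCurvature_eq`, `ArcChain.closedTotalCurvature_eq`). The upper bound is the triangle
inequality for angles, the lower bound uses fine inscribed polygons. In projective space a curve
lifts to a chain of arcs, unique up to sign; length and rotation are those of the lift, and a closed
curve may lift to one whose endpoints are antipodal. -/

/-- The component of `L y` orthogonal to `L x`. For `L` the projection onto a plane `p` and `y ⊥ x`,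
this is, up to a positive factor, the image of the tangent vector `y` at `x` under the differential
of the nearest-point projection onto the sphere of `p`. -/
def tang {N : ℕ} (L : Euc N →L[ℝ] Euc N) (x : Euc N) : Euc N →ₗ[ℝ] Euc N where
  toFun y := L y - (⟪L x, L y⟫ / ‖L x‖ ^ 2) • L x
  map_add' y z := by
    simp only [map_add, inner_add_right, add_div, add_smul]; abel
  map_smul' c y := by
    simp only [map_smul, inner_smul_right, mul_div_assoc, mul_smul, smul_sub, RingHom.id_apply]

theorem tang_apply {N : ℕ} (L : Euc N →L[ℝ] Euc N) (x y : Euc N) :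
    tang L x y = L y - (⟪L x, L y⟫ / ‖L x‖ ^ 2) • L x := rfl

/-- Division by zero gives zero, so the base point `0` removes nothing. This makes lengths a special
case of the statements about turning angles. -/
theorem tang_zero_left {N : ℕ} (L : Euc N →L[ℝ] Euc N) (y : Euc N) : tang L 0 y = L y := by
  simp [tang_apply]

theorem tang_self {N : ℕ} (L : Euc N →L[ℝ] Euc N) (x : Euc N) : tang L x x = 0 := by
  rw [tang_apply, real_inner_self_eq_norm_sq]
  by_cases h : L x = 0
  · simp [h]
  · rw [div_self (by positivity), one_smul, sub_self]

theorem tang_neg_left {N : ℕ} (L : Euc N →L[ℝ] Euc N) (x y : Euc N) :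
    tang L (-x) y = tang L x y := by
  simp [tang_apply, neg_div]

/-- The projection onto `g p` is the conjugate of the projection onto `p` by `g`. This turns
invariance of the measure into symmetries of the mean angle. -/
theorem tang_rotate {N k : ℕ} (g : OrthGroup N) (p : Gr N k) (x y : Euc N) :
    tang (Gr.rotate g p).proj (Unitary.linearIsometryEquiv g x) (Unitary.linearIsometryEquiv g y)
      = Unitary.linearIsometryEquiv g (tang p.proj x y) := by
  have h : ∀ z, (Gr.rotate g p).proj (Unitary.linearIsometryEquiv g z)
      = Unitary.linearIsometryEquiv g (p.proj z) := by
    intro z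
    have := Submodule.starProjection_map_apply (Unitary.linearIsometryEquiv g) p.1
      (Unitary.linearIsometryEquiv g z)
    rw [LinearIsometryEquiv.symm_apply_apply] at this
    exact this
  simp only [tang_apply, h, map_sub, map_smul, LinearIsometryEquiv.norm_map,
    LinearIsometryEquiv.inner_map_map]

/-! ### Measurability and almost sure nondegeneracy of random projections -/

theorem continuous_proj_apply {N k : ℕ} (x : Euc N) : Continuous fun p : Gr N k => p.proj x := by
  have : Continuous (Gr.proj : Gr N k → _) := continuous_induced_dom
  fun_prop

theorem measurable_tang {N k : ℕ} (x y : Euc N) :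
    Measurable fun p : Gr N k => tang p.proj x y := by
  have h : ∀ z, Measurable fun p : Gr N k => p.proj z := fun z =>
    (continuous_proj_apply z).measurable
  simp only [tang_apply]
  have hx := h x
  have hy := h y
  exact hy.sub (((hx.inner hy).div (hx.norm.pow_const 2)).smul hx)

theorem measurable_angle {Ω E : Type*} [MeasurableSpace Ω] [NormedAddCommGroup E]
    [InnerProductSpace ℝ E] [MeasurableSpace E] [BorelSpace E] [SecondCountableTopology E]
    {f g : Ω → E} (hf : Measurable f) (hg : Measurable g) :
    Measurable fun ω => angle (f ω) (g ω) := by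
  unfold angle
  exact Real.continuous_arccos.measurable.comp ((hf.inner hg).div (hf.norm.mul hg.norm))

/-- The law of a random plane is invariant under linear isometries. -/
theorem measurePreserving_rotate (N k : ℕ) (h : k ≤ N + 1) (g : OrthGroup N) :
    MeasurePreserving (Gr.rotate g) (grMeasure N k h) (grMeasure N k h) :=
  ⟨(Gr.continuous_rotate g).measurable, grMeasure_map_rotate N k h g⟩

/-- Otherwise each vector of `p` would be a multiple of `p.proj x`, and `p` would have dimension at
most one. -/
theorem tang_ker_ne_top {N k : ℕ} (hk : 2 ≤ k) (p : Gr N k) (x : Euc N) :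
    LinearMap.ker (tang p.proj x) ≠ ⊤ := by
  intro htop
  have hle : p.1 ≤ ℝ ∙ p.proj x := by
    intro y hy
    have h0 : tang p.proj x y = 0 := by
      rw [← LinearMap.mem_ker, htop]; trivial
    rw [tang_apply, sub_eq_zero] at h0
    have : p.proj y = y := Submodule.starProjection_eq_self_iff.2 hy
    rw [this] at h0
    rw [h0]
    exact Submodule.smul_mem _ _ (Submodule.mem_span_singleton_self _)
  have := (Submodule.finrank_mono hle).trans (finrank_span_le_card _)
  simp only [toFinset_singleton, Finset.card_singleton] at this
  rw [p.2] at this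
  omega

/-- The points of the moment curve with natural parameters. -/
def momentCurve (N : ℕ) (t : ℕ) : Euc N := WithLp.toLp 2 fun i => (t : ℝ) ^ (i : ℕ)

/-- A nonzero vector orthogonal to `H` supplies the coefficients of a nonzero polynomial that
vanishes at all these parameters. -/
theorem finite_momentCurve_mem {N : ℕ} {H : Submodule ℝ (Euc N)} (hH : H ≠ ⊤) :
    {t : ℕ | momentCurve N t ∈ H}.Finite := by
  obtain ⟨z, hz, hz0⟩ : ∃ z ∈ Hᗮ, z ≠ 0 := by
    by_contra! hcon
    exact hH ((Submodule.orthogonal_eq_bot_iff).1 ((Submodule.eq_bot_iff _).2 hcon))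
  let P : Polynomial ℝ := ∑ i : Fin (N + 1), Polynomial.monomial (i : ℕ) (z i)
  have hP : P ≠ 0 := by
    intro h0
    apply hz0
    ext i
    have := congrArg (fun Q => Polynomial.coeff Q (i : ℕ)) h0
    simpa [P, Polynomial.finsetSum_coeff, Polynomial.coeff_monomial, Fin.val_inj] using this
  have hfin := (Polynomial.finite_setOfPred_isRoot hP)
  refine Finite.subset (hfin.preimage (f := fun t : ℕ => (t : ℝ)) Nat.cast_injective.injOn) ?_
  intro t ht
  have h0 : ⟪momentCurve N t, z⟫ = 0 := hz _ ht
  have h1 : ⟪momentCurve N t, z⟫ = P.eval (t : ℝ) := by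
    simp [PiLp.inner_apply, momentCurve, P, Polynomial.eval_finsetSum]
  simp only [mem_preimage, mem_ofPred_eq, Polynomial.IsRoot.def]
  rw [← h1, h0]

/-- Rotating `p` by `ρ`, which fixes `x`, carries one event to the other and preserves the measure.
-/
theorem measure_tang_eq_zero_congr {N k : ℕ} (h : k ≤ N + 1) (ρ : Euc N ≃ₗᵢ[ℝ] Euc N)
    {x : Euc N} (hx : ρ x = x) (y : Euc N) :
    grMeasure N k h {p | tang p.proj x (ρ y) = 0} = grMeasure N k h {p | tang p.proj x y = 0} := by
  set g : OrthGroup N := Unitary.linearIsometryEquiv.symm ρ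
  have hg : Unitary.linearIsometryEquiv g = ρ := by simp [g]
  have hm : MeasurableSet {p : Gr N k | tang p.proj x (ρ y) = 0} :=
    (measurable_tang x (ρ y)) (measurableSet_singleton 0)
  rw [← (measurePreserving_rotate N k h g).measure_preimage hm.nullMeasurableSet]
  congr 1
  ext p
  have := tang_rotate g p x y
  rw [hg, hx] at this
  simp [this]

theorem reflection_apply_of_inner_eq_zero {N : ℕ} {n x : Euc N} (h : ⟪n, x⟫ = 0) :
    (ℝ ∙ n)ᗮ.reflection x = x :=
  (Submodule.reflection_eq_self_iff x).2 (Submodule.mem_orthogonal_singleton_iff_inner_right.2 h)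

/-- The projection to a random plane `p` of dimension at least two maps independent vectors
to independent vectors, almost surely. -/
theorem ae_tang_ne_zero {N k : ℕ} (h : k ≤ N + 1) (hk : 2 ≤ k) {x y : Euc N}
    (hxy : ⟪x, y⟫ = 0) (hy : y ≠ 0) : ∀ᵐ p ∂grMeasure N k h, tang p.proj x y ≠ 0 := by
  set μ := grMeasure N k h
  -- Each `A t` turns out to be at least as likely as the bad event, while each plane lies in only
  -- finitely many `A t`; so the bad event is null.
  let A : ℕ → Set (Gr N k) := fun t => {p | tang p.proj x (momentCurve N t) = 0}
  have hAm : ∀ t, MeasurableSet (A t) := fun t =>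
    (measurable_tang x _) (measurableSet_singleton 0)
  have hle : ∀ t, μ {p | tang p.proj x y = 0} ≤ μ (A t) := by
    intro t
    -- Only the component orthogonal to `x` matters. Rescaled to the norm of `y`, it is exchanged
    -- with `y` by a reflection that fixes `x`.
    set b : Euc N := momentCurve N t - (⟪x, momentCurve N t⟫ / ‖x‖ ^ 2) • x
    have hA : A t = {p | tang p.proj x b = 0} := by
      ext p; simp [A, b, tang_self]
    have hxb : ⟪x, b⟫ = 0 := by
      simp only [b, inner_sub_right, inner_smul_right, real_inner_self_eq_norm_sq]
      by_cases hx : x = 0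
      · simp [hx]
      · field_simp; ring
    by_cases hb : b = 0
    · rw [hA]
      refine measure_mono fun p _ => ?_
      simp [hb]
    set c : ℝ := ‖y‖ / ‖b‖
    have hc : c ≠ 0 := by positivity
    have hA' : A t = {p | tang p.proj x (c • b) = 0} := by
      rw [hA]; ext p; simp [hc]
    have hn : ‖y‖ = ‖c • b‖ := by
      rw [norm_smul, Real.norm_of_nonneg (by positivity)]
      simp only [c]; field_simp
    have h1 : (ℝ ∙ (y - c • b))ᗮ.reflection x = x := by
      apply reflection_apply_of_inner_eq_zero
      rw [inner_sub_left, inner_smul_left, real_inner_comm, hxy, real_inner_comm, hxb]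
      simp
    have h2 := measure_tang_eq_zero_congr h _ h1 y
    rw [Submodule.reflection_sub hn] at h2
    rw [hA', h2]
  -- The upper limit of the events is empty: the kernel of `tang p.proj x` is a proper subspace and
  -- meets the moment curve at finitely many parameters.
  have hempty : ⋂ n, ⋃ t ∈ Ici n, A t = ∅ := by
    rw [eq_empty_iff_forall_notMem]
    intro p hp
    have hfin := finite_momentCurve_mem (tang_ker_ne_top hk p x)
    obtain ⟨n, hn⟩ := hfin.bddAbove
    have := mem_iInter.1 hp (n + 1)
    simp only [mem_iUnion] at this
    obtain ⟨t, ht, hpt⟩ := this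
    have h3 : t ≤ n := hn (show momentCurve N t ∈ LinearMap.ker (tang p.proj x) from hpt)
    have h4 : n + 1 ≤ t := ht
    omega
  have htend := tendsto_measure_iInter_atTop (μ := μ) (s := fun n : ℕ => ⋃ t ∈ Ici n, A t)
    (fun n => (MeasurableSet.biUnion (to_countable _) fun t _ => hAm t).nullMeasurableSet)
    (fun n m hnm => biUnion_subset_biUnion_left (Ici_subset_Ici.2 hnm))
    ⟨0, measure_ne_top _ _⟩
  rw [hempty, measure_empty] at htend
  have h0 : μ {p | tang p.proj x y = 0} ≤ 0 := by
    refine ge_of_tendsto' htend fun n => (hle n).trans (measure_mono ?_)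
    exact subset_biUnion_of_mem (u := A) (mem_Ici.2 le_rfl)
  rw [ae_iff]
  simpa using h0

/-! ### The mean angle -/

/-- The mean angle between the components of the projections of `y` and `z` orthogonal to that
of `x`. -/
def meanAngle {N k : ℕ} (h : k ≤ N + 1) (x y z : Euc N) : ℝ :=
  ∫ p, angle (tang p.proj x y) (tang p.proj x z) ∂grMeasure N k h

theorem integrable_angle_tang {N k : ℕ} (h : k ≤ N + 1) (x y z : Euc N) :
    Integrable (fun p : Gr N k => angle (tang p.proj x y) (tang p.proj x z))
      (grMeasure N k h) := by
  refine Integrable.of_bound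
    (measurable_angle (measurable_tang x y) (measurable_tang x z)).aestronglyMeasurable Real.pi
    (Filter.Eventually.of_forall fun p => ?_)
  rw [Real.norm_of_nonneg (angle_nonneg _ _)]
  exact angle_le_pi _ _

/-- Change of variables `p ↦ g p` in the integral; isometries preserve angles. -/
theorem meanAngle_map {N k : ℕ} (h : k ≤ N + 1) (ρ : Euc N ≃ₗᵢ[ℝ] Euc N) {x : Euc N}
    (hx : ρ x = x) (y z : Euc N) : meanAngle h x (ρ y) (ρ z) = meanAngle h x y z := by
  set g : OrthGroup N := Unitary.linearIsometryEquiv.symm ρ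
  have hg : Unitary.linearIsometryEquiv g = ρ := by simp [g]
  unfold meanAngle
  conv_lhs => rw [← grMeasure_map_rotate N k h g]
  rw [integral_map (Gr.continuous_rotate g).measurable.aemeasurable
    (measurable_angle (measurable_tang _ _) (measurable_tang _ _)).aestronglyMeasurable]
  refine integral_congr_ae (Filter.Eventually.of_forall fun p => ?_)
  have h1 := tang_rotate g p x y
  have h2 := tang_rotate g p x z
  rw [hg, hx] at h1 h2
  simp only [h1, h2]
  exact ρ.toLinearIsometry.angle_map _ _

theorem meanAngle_comm {N k : ℕ} (h : k ≤ N + 1) (x y z : Euc N) :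
    meanAngle h x y z = meanAngle h x z y := by
  simp only [meanAngle, angle_comm]

/-- The crude bound that starts the halving argument in `meanAngle_circ`. -/
theorem abs_meanAngle_sub_le {N k : ℕ} (h : k ≤ N + 1) (x y z : Euc N) {θ : ℝ}
    (h0 : 0 ≤ θ) (h1 : θ ≤ Real.pi) : |meanAngle h x y z - θ| ≤ Real.pi := by
  have h2 : 0 ≤ meanAngle h x y z := integral_nonneg fun p => angle_nonneg _ _
  have h3 : meanAngle h x y z ≤ Real.pi := by
    have := integral_mono (integrable_angle_tang h x y z) (integrable_const Real.pi)
      fun p => angle_le_pi _ _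
    simpa [meanAngle] using this
  rw [abs_le]; constructor <;> linarith

/-- The unit vector at angle `θ` from `v` in the oriented plane with orthonormal basis `v`, `w`. -/
def circ {N : ℕ} (v w : Euc N) (θ : ℝ) : Euc N := Real.cos θ • v + Real.sin θ • w

theorem inner_circ_right {N : ℕ} {v w : Euc N} {x : Euc N} (hv : ⟪x, v⟫ = 0) (hw : ⟪x, w⟫ = 0)
    (θ : ℝ) : ⟪x, circ v w θ⟫ = 0 := by
  simp [circ, inner_add_right, inner_smul_right, hv, hw]

theorem inner_circ_circ {N : ℕ} {v w : Euc N} (hv : ‖v‖ = 1) (hw : ‖w‖ = 1) (hvw : ⟪v, w⟫ = 0)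
    (θ η : ℝ) : ⟪circ v w θ, circ v w η⟫ = Real.cos (θ - η) := by
  have hwv : ⟪w, v⟫ = 0 := by rw [real_inner_comm, hvw]
  simp only [circ, inner_add_left, inner_add_right, inner_smul_left, inner_smul_right, hvw, hwv,
    real_inner_self_eq_norm_sq, hv, hw, Real.cos_sub]
  simp
  ring

theorem norm_circ {N : ℕ} {v w : Euc N} (hv : ‖v‖ = 1) (hw : ‖w‖ = 1) (hvw : ⟪v, w⟫ = 0)
    (θ : ℝ) : ‖circ v w θ‖ = 1 := by
  have := inner_circ_circ hv hw hvw θ θ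
  rw [real_inner_self_eq_norm_sq, sub_self, Real.cos_zero] at this
  nlinarith [norm_nonneg (circ v w θ)]

theorem circ_ne_zero {N : ℕ} {v w : Euc N} (hv : ‖v‖ = 1) (hw : ‖w‖ = 1) (hvw : ⟪v, w⟫ = 0)
    (θ : ℝ) : circ v w θ ≠ 0 := by
  rw [← norm_ne_zero_iff, norm_circ hv hw hvw]; exact one_ne_zero

theorem angle_circ_circ {N : ℕ} {v w : Euc N} (hv : ‖v‖ = 1) (hw : ‖w‖ = 1) (hvw : ⟪v, w⟫ = 0)
    {θ η : ℝ} (h : θ ≤ η) (h' : η ≤ θ + Real.pi) : angle (circ v w θ) (circ v w η) = η - θ := by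
  rw [angle, inner_circ_circ hv hw hvw, norm_circ hv hw hvw, norm_circ hv hw hvw, mul_one, div_one,
    ← neg_sub, Real.cos_neg, Real.arccos_cos] <;> linarith

theorem circ_zero {N : ℕ} (v w : Euc N) : circ v w 0 = v := by simp [circ]

theorem circ_pi {N : ℕ} (v w : Euc N) : circ v w Real.pi = -v := by simp [circ]

/-- Reflections of a plane reverse the angles. -/
theorem exists_reflection_circ {N : ℕ} {v w : Euc N} (hv : ‖v‖ = 1) (hw : ‖w‖ = 1)
    (hvw : ⟪v, w⟫ = 0) (c : ℝ) : ∃ ρ : Euc N ≃ₗᵢ[ℝ] Euc N,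
      (∀ θ, ρ (circ v w θ) = circ v w (c - θ)) ∧ ∀ x, ⟪x, v⟫ = 0 → ⟪x, w⟫ = 0 → ρ x = x := by
  -- The mirror contains the direction at angle `c / 2`, so its normal is a quarter turn further.
  -- Vectors orthogonal to `v` and `w` are orthogonal to `n`, hence fixed.
  set n := circ v w (c / 2 + Real.pi / 2)
  refine ⟨(ℝ ∙ n)ᗮ.reflection, fun θ => ?_, fun x hxv hxw => ?_⟩
  · rw [Submodule.reflection_orthogonal_apply, Submodule.reflection_singleton_apply,
      norm_circ hv hw hvw, inner_circ_circ hv hw hvw]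
    have e1 : Real.cos (c - θ) = Real.cos θ
        - 2 * Real.cos (c / 2 + Real.pi / 2 - θ) * Real.cos (c / 2 + Real.pi / 2) := by
      have h2 : c - θ = (c / 2 - θ) + c / 2 := by ring
      have h3 : Real.cos θ = Real.cos (c / 2 - (c / 2 - θ)) := by congr 1; ring
      have h4 : c / 2 + Real.pi / 2 - θ = (c / 2 - θ) + Real.pi / 2 := by ring
      rw [h4, h3, h2, Real.cos_add_pi_div_two, Real.cos_add_pi_div_two, Real.cos_add,
        Real.cos_sub (c / 2) (c / 2 - θ)]
      ring
    have e2 : Real.sin (c - θ) = Real.sin θ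
        - 2 * Real.cos (c / 2 + Real.pi / 2 - θ) * Real.sin (c / 2 + Real.pi / 2) := by
      have h2 : c - θ = (c / 2 - θ) + c / 2 := by ring
      have h3 : Real.sin θ = Real.sin (c / 2 - (c / 2 - θ)) := by congr 1; ring
      have h4 : c / 2 + Real.pi / 2 - θ = (c / 2 - θ) + Real.pi / 2 := by ring
      rw [h4, h3, h2, Real.cos_add_pi_div_two, Real.sin_add_pi_div_two, Real.sin_add,
        Real.sin_sub (c / 2) (c / 2 - θ)]
      ring
    simp only [n, circ, e1, e2]
    simp only [RCLike.ofReal_real_eq_id, id, one_pow, div_one]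
    module
  · apply reflection_apply_of_inner_eq_zero
    rw [real_inner_comm]
    exact inner_circ_right hxv hxw _

/-- The middle direction as a combination of the outer two, with coefficients that are nonnegative
when the angles stay in `[0, π]`. Being linear, the relation survives every projection. -/
theorem smul_circ_add {N : ℕ} (v w : Euc N) (a b : ℝ) :
    Real.sin (a + b) • circ v w a = Real.sin b • circ v w 0 + Real.sin a • circ v w (a + b) := by
  simp only [circ, Real.sin_add, Real.cos_add, Real.cos_zero, Real.sin_zero]
  have h := Real.sin_sq_add_cos_sq a
  simp only [smul_add, smul_smul]
  match_scalars
  · linear_combination Real.sin b * h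
  · ring

/-- The middle vector lies in the convex cone of the outer two, where angles add. -/
theorem angle_add_of_smul_eq {V : Type*} [NormedAddCommGroup V] [InnerProductSpace ℝ V]
    {x y z : V} (hy : y ≠ 0) {a b c : ℝ} (ha : 0 ≤ a) (hb : 0 ≤ b) (hc : 0 < c)
    (h : c • y = a • x + b • z) : angle x z = angle x y + angle y z := by
  refine angle_eq_angle_add_add_angle_add_of_mem_span hy ?_
  rw [Submodule.mem_span_pair]
  refine ⟨(a / c).toNNReal, (b / c).toNNReal, ?_⟩
  rw [NNReal.smul_def, NNReal.smul_def, Real.coe_toNNReal _ (by positivity),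
    Real.coe_toNNReal _ (by positivity)]
  rw [← inv_smul_smul₀ hc.ne' y, h, smul_add, smul_smul, smul_smul]
  simp [div_eq_inv_mul]

/-- A reflection moves the second piece, from `a` to `a + b`, onto the piece from `0` to `b`, so its
mean angle depends on `b` alone. For almost every plane the two projected angles add up. -/
theorem meanAngle_add {N k : ℕ} (h : k ≤ N + 1) (hk : 2 ≤ k) {x v w : Euc N} (hv : ‖v‖ = 1)
    (hw : ‖w‖ = 1) (hvw : ⟪v, w⟫ = 0) (hxv : ⟪x, v⟫ = 0) (hxw : ⟪x, w⟫ = 0) {a b : ℝ}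
    (ha : 0 ≤ a) (hb : 0 ≤ b) (hab : a + b ≤ Real.pi) :
    meanAngle h x v (circ v w (a + b)) = meanAngle h x v (circ v w a)
      + meanAngle h x v (circ v w b) := by
  obtain ⟨ρ, hρ, hρx⟩ := exists_reflection_circ hv hw hvw (a + b)
  have h1 : meanAngle h x v (circ v w b) = meanAngle h x (circ v w a) (circ v w (a + b)) := by
    have := meanAngle_map h ρ (hρx x hxv hxw) (circ v w a) (circ v w (a + b))
    rw [← this, hρ, hρ, add_sub_cancel_left, sub_self, circ_zero, meanAngle_comm]
  rw [h1]
  unfold meanAngle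
  rw [← integral_add (integrable_angle_tang h _ _ _) (integrable_angle_tang h _ _ _)]
  refine integral_congr_ae ?_
  filter_upwards [ae_tang_ne_zero h hk (inner_circ_right hxv hxw a) (circ_ne_zero hv hw hvw a),
    ae_tang_ne_zero h hk hxv (by rw [← norm_ne_zero_iff, hv]; exact one_ne_zero)] with p hp hpv
  rcases hab.lt_or_eq with hlt | heq
  · rcases (add_nonneg ha hb).eq_or_lt with h0 | hpos
    · have ha0 : a = 0 := by linarith
      have hb0 : b = 0 := by linarith
      simp [ha0, hb0, circ_zero, angle_self hpv]
    · refine angle_add_of_smul_eq hp (Real.sin_nonneg_of_nonneg_of_le_pi hb (by linarith))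
        (Real.sin_nonneg_of_nonneg_of_le_pi ha (by linarith)) (Real.sin_pos_of_pos_of_lt_pi hpos hlt)
        ?_
      rw [← map_smul, smul_circ_add, circ_zero, map_add, map_smul, map_smul]
  -- For total angle `π` the coefficient `sin (a + b)` vanishes and the cone argument fails; the
  -- outer vectors are opposite and the two angles are supplementary.
  · rw [heq, circ_pi, map_neg, angle_self_neg_of_nonzero hpv, angle_neg_right,
      angle_comm (tang p.proj x (circ v w a))]
    ring

theorem meanAngle_circ {N k : ℕ} (h : k ≤ N + 1) (hk : 2 ≤ k) {x v w : Euc N} (hv : ‖v‖ = 1)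
    (hw : ‖w‖ = 1) (hvw : ⟪v, w⟫ = 0) (hxv : ⟪x, v⟫ = 0) (hxw : ⟪x, w⟫ = 0) {θ : ℝ}
    (h0 : 0 ≤ θ) (h1 : θ ≤ Real.pi) : meanAngle h x v (circ v w θ) = θ := by
  have hadd := fun a b => meanAngle_add h hk hv hw hvw hxv hxw (a := a) (b := b)
  have hpi : meanAngle h x v (circ v w Real.pi) = Real.pi := by
    have hae : ∀ᵐ p ∂grMeasure N k h,
        angle (tang p.proj x v) (tang p.proj x (circ v w Real.pi)) = Real.pi := by
      filter_upwards [ae_tang_ne_zero h hk hxv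
        (by rw [← norm_ne_zero_iff, hv]; exact one_ne_zero)] with p hpv
      rw [circ_pi, map_neg, angle_self_neg_of_nonzero hpv]
    rw [meanAngle, integral_congr_ae hae]
    simp
  -- Below `π / 2`, doubling the angle and using additivity halves the error; above, the error at
  -- `θ` is opposite to the one at `π - θ`.
  have key : ∀ n : ℕ, ∀ θ, 0 ≤ θ → θ ≤ Real.pi →
      |meanAngle h x v (circ v w θ) - θ| ≤ Real.pi / 2 ^ n := by
    intro n
    induction n with
    | zero =>
      intro θ h0 h1
      simpa using abs_meanAngle_sub_le h x v (circ v w θ) h0 h1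
    | succ n ih =>
      have small : ∀ θ, 0 ≤ θ → θ ≤ Real.pi / 2 →
          |meanAngle h x v (circ v w θ) - θ| ≤ Real.pi / 2 ^ (n + 1) := by
        intro θ h0 h1
        have h2 := ih (θ + θ) (by linarith) (by linarith)
        rw [hadd θ θ h0 h0 (by linarith), ← two_mul, ← two_mul, ← mul_sub, abs_mul, abs_two] at h2
        rw [pow_succ, ← div_div]
        linarith
      intro θ h0 h1
      rcases le_total θ (Real.pi / 2) with hle | hle
      · exact small θ h0 hle
      · have h2 := small (Real.pi - θ) (by linarith) (by linarith)
        have h3 := hadd θ (Real.pi - θ) h0 (by linarith) (by linarith)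
        rw [add_sub_cancel, hpi] at h3
        rw [← abs_neg]
        convert h2 using 2
        linarith
  have hlim : Filter.Tendsto (fun n : ℕ => Real.pi / 2 ^ n) Filter.atTop (nhds 0) := by
    have := (tendsto_pow_atTop_nhds_zero_of_lt_one (r := (1 / 2 : ℝ)) (by norm_num)
      (by norm_num)).const_mul Real.pi
    simpa [div_eq_mul_inv] using this
  have := ge_of_tendsto' hlim fun n => key n θ h0 h1
  exact sub_eq_zero.1 (abs_nonpos_iff.1 this)

/-- A pair of unit vectors `y`, `z` lies in an oriented plane, with `y` at angle zero. -/
theorem meanAngle_eq_angle {N k : ℕ} (h : k ≤ N + 1) (hk : 2 ≤ k) {x y z : Euc N}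
    (hxy : ⟪x, y⟫ = 0) (hxz : ⟪x, z⟫ = 0) (hy : y ≠ 0) (hz : z ≠ 0) :
    meanAngle h x y z = angle y z := by
  have main : ∀ y z : Euc N, ⟪x, y⟫ = 0 → ⟪x, z⟫ = 0 → ‖y‖ = 1 → ‖z‖ = 1 →
      meanAngle h x y z = angle y z := by
    intro y z hxy hxz hy hz
    have hy0 : y ≠ 0 := by rw [← norm_ne_zero_iff, hy]; exact one_ne_zero
    set r : Euc N := z - ⟪y, z⟫ • y
    have hyr : ⟪y, r⟫ = 0 := by
      simp [r, inner_sub_right, inner_smul_right, hy]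
    have hzr : z = ⟪y, z⟫ • y + r := by simp [r]
    -- Collinear `y` and `z` span no plane: the projected angle is then almost surely `0` or `π`.
    by_cases hr : r = 0
    · rw [hr, add_zero] at hzr
      have hc : |⟪y, z⟫| = 1 := by
        have := congrArg norm hzr
        rw [norm_smul, hy, hz, mul_one] at this
        exact this.symm
      rcases eq_or_eq_neg_of_abs_eq hc with hc | hc
      · rw [hc, one_smul] at hzr
        subst hzr
        rw [angle_self hy0, meanAngle]
        have : ∀ᵐ p ∂grMeasure N k h, angle (tang p.proj x z) (tang p.proj x z) = 0 := by
          filter_upwards [ae_tang_ne_zero h hk hxz hy0] with p hp using angle_self hp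
        rw [integral_congr_ae this]; simp
      · rw [hc, neg_smul, one_smul] at hzr
        rw [hzr, angle_self_neg_of_nonzero hy0, meanAngle]
        have : ∀ᵐ p ∂grMeasure N k h, angle (tang p.proj x y) (tang p.proj x (-y)) = Real.pi := by
          filter_upwards [ae_tang_ne_zero h hk hxy hy0] with p hp
          rw [map_neg, angle_self_neg_of_nonzero hp]
        rw [integral_congr_ae this]; simp
    · set w : Euc N := ‖r‖⁻¹ • r
      have hw : ‖w‖ = 1 := norm_smul_inv_norm hr
      have hyw : ⟪y, w⟫ = 0 := by simp [w, inner_smul_right, hyr]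
      have hxw : ⟪x, w⟫ = 0 := by
        simp [w, r, inner_smul_right, inner_sub_right, hxy, hxz]
      have hnr : ‖r‖ = Real.sin (angle y z) := by
        have h1 := Real.sin_sq_add_cos_sq (angle y z)
        rw [← inner_eq_cos_angle_of_norm_eq_one hy hz] at h1
        have h2 : ‖r‖ ^ 2 = 1 - ⟪y, z⟫ ^ 2 := by
          rw [← real_inner_self_eq_norm_sq]
          simp only [r, inner_sub_left, inner_sub_right, inner_smul_left, inner_smul_right,
            real_inner_self_eq_norm_sq, hy, hz, real_inner_comm y z]
          simp; ring
        have h3 := sin_angle_nonneg y z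
        have : ‖r‖ ^ 2 = Real.sin (angle y z) ^ 2 := by linarith
        exact (sq_eq_sq₀ (norm_nonneg _) h3).1 this
      have hz' : z = circ y w (angle y z) := by
        rw [circ, ← inner_eq_cos_angle_of_norm_eq_one hy hz, ← hnr]
        rw [hzr]
        simp only [w]
        rw [smul_smul, mul_inv_cancel₀ (norm_ne_zero_iff.2 hr), one_smul]
        congr 2
        rw [← hzr]
      conv_lhs => rw [hz']
      exact meanAngle_circ h hk hy hw hyw hxy hxw (angle_nonneg _ _) (angle_le_pi _ _)
  have hy' : 0 < ‖y‖⁻¹ := by positivity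
  have hz' : 0 < ‖z‖⁻¹ := by positivity
  have := main (‖y‖⁻¹ • y) (‖z‖⁻¹ • z) (by simp [inner_smul_right, hxy])
    (by simp [inner_smul_right, hxz]) (norm_smul_inv_norm hy) (norm_smul_inv_norm hz)
  simpa only [meanAngle, map_smul, angle_smul_left_of_pos _ _ hy',
    angle_smul_right_of_pos _ _ hz'] using this

/-- The mean of the angles between the projections of two vectors is their angle. -/
theorem lintegral_angle_tang {N k : ℕ} (h : k ≤ N + 1) (hk : 2 ≤ k) {x y z : Euc N}
    (hxy : ⟪x, y⟫ = 0) (hxz : ⟪x, z⟫ = 0) (hy : y ≠ 0) (hz : z ≠ 0) :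
    ∫⁻ p, ENNReal.ofReal (angle (tang p.proj x y) (tang p.proj x z)) ∂grMeasure N k h
      = ENNReal.ofReal (angle y z) := by
  rw [← meanAngle_eq_angle h hk hxy hxz hy hz, meanAngle,
    ofReal_integral_eq_lintegral_ofReal (integrable_angle_tang h x y z)
      (Filter.Eventually.of_forall fun p => angle_nonneg _ _)]

/-! ### Arcs of great circles -/

/-- Moves the base of the angle to another point of the circle, so that pieces of arcs are again
arcs. -/
theorem circ_circ {N : ℕ} (v w : Euc N) (a b : ℝ) :
    circ (circ v w a) (circ v w (a + Real.pi / 2)) b = circ v w (a + b) := by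
  simp only [circ, Real.cos_add_pi_div_two, Real.sin_add_pi_div_two]
  simp only [Real.cos_add, Real.sin_add]
  module

/-- A chord has the direction of the tangent at its mid-angle. All later angles between chords and
tangents come from this. -/
theorem circ_sub_circ {N : ℕ} (v w : Euc N) (a b : ℝ) :
    circ v w b - circ v w a
      = (2 * Real.sin ((b - a) / 2)) • circ v w ((a + b) / 2 + Real.pi / 2) := by
  have ha : a = (a + b) / 2 - (b - a) / 2 := by ring
  have hb : b = (a + b) / 2 + (b - a) / 2 := by ring
  simp only [circ, Real.cos_add_pi_div_two, Real.sin_add_pi_div_two]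
  have h1 : Real.cos a = Real.cos ((a + b) / 2 - (b - a) / 2) := by rw [← ha]
  have h2 : Real.cos b = Real.cos ((a + b) / 2 + (b - a) / 2) := by rw [← hb]
  have h3 : Real.sin a = Real.sin ((a + b) / 2 - (b - a) / 2) := by rw [← ha]
  have h4 : Real.sin b = Real.sin ((a + b) / 2 + (b - a) / 2) := by rw [← hb]
  rw [h1, h2, h3, h4, Real.cos_add, Real.cos_sub, Real.sin_add, Real.sin_sub]
  module

/-- On `[s,t]` the curve `γ` runs along the arc of a great circle starting from `v` in the direction
of `w`, with angle function `φ` of positive speed, for a total angle less than `π`. -/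
structure ArcData {N : ℕ} (γ : ℝ → Euc N) (s t : ℝ) (v w : Euc N) (φ : ℝ → ℝ) : Prop where
  lt : s < t
  norm_left : ‖v‖ = 1
  norm_right : ‖w‖ = 1
  inner_eq : ⟪v, w⟫ = 0
  zero : φ s = 0
  lt_pi : φ t < Real.pi
  deriv : ∀ x ∈ Icc s t, ∃ d : ℝ, 0 < d ∧ HasDerivWithinAt φ d (Icc s t) x
  eq : ∀ x ∈ Icc s t, γ x = circ v w (φ x)

/-- On `[s,t]` the curve `γ` runs along an arc of a great circle, shorter than `π`, with positive
(not necessarily constant) speed. -/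
def IsArc {N : ℕ} (γ : ℝ → Euc N) (s t : ℝ) : Prop := ∃ v w φ, ArcData γ s t v w φ

/-- The right tangent vector. -/
def rightTan {N : ℕ} (γ : ℝ → Euc N) (s : ℝ) : Euc N := derivWithin γ (Ici s) s

/-- The left tangent vector. -/
def leftTan {N : ℕ} (γ : ℝ → Euc N) (s : ℝ) : Euc N := derivWithin γ (Iic s) s

theorem turningAngle_eq {N : ℕ} (γ : ℝ → Euc N) (s : ℝ) :
    turningAngle γ s = angle (leftTan γ s) (rightTan γ s) := rfl

theorem hasDerivAt_circ {N : ℕ} (v w : Euc N) (θ : ℝ) :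
    HasDerivAt (circ v w) (circ v w (θ + Real.pi / 2)) θ := by
  have h := ((Real.hasDerivAt_cos θ).smul_const v).add ((Real.hasDerivAt_sin θ).smul_const w)
  rw [circ, Real.cos_add_pi_div_two, Real.sin_add_pi_div_two]
  exact h

namespace ArcData

variable {N : ℕ} {γ : ℝ → Euc N} {s t : ℝ} {v w : Euc N} {φ : ℝ → ℝ}

theorem continuousOn_angle (A : ArcData γ s t v w φ) : ContinuousOn φ (Icc s t) := fun x hx =>
  let ⟨_, _, h⟩ := A.deriv x hx
  h.continuousWithinAt

theorem strictMonoOn (A : ArcData γ s t v w φ) : StrictMonoOn φ (Icc s t) := by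
  refine strictMonoOn_of_deriv_pos (convex_Icc s t) A.continuousOn_angle fun x hx => ?_
  rw [interior_Icc] at hx
  obtain ⟨d, hd, h⟩ := A.deriv x (Ioo_subset_Icc_self hx)
  rwa [(h.hasDerivAt (Icc_mem_nhds hx.1 hx.2)).deriv]

theorem hasDerivWithinAt (A : ArcData γ s t v w φ) {x : ℝ} (hx : x ∈ Icc s t) :
    ∃ d : ℝ, 0 < d ∧ HasDerivWithinAt γ (d • circ v w (φ x + Real.pi / 2)) (Icc s t) x := by
  obtain ⟨d, hd, h⟩ := A.deriv x hx
  refine ⟨d, hd, ?_⟩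
  exact ((hasDerivAt_circ v w (φ x)).scomp_hasDerivWithinAt x h).congr A.eq (A.eq x hx)

theorem left_mem (A : ArcData γ s t v w φ) : s ∈ Icc s t := left_mem_Icc.2 A.lt.le

theorem right_mem (A : ArcData γ s t v w φ) : t ∈ Icc s t := right_mem_Icc.2 A.lt.le

theorem hasDerivWithinAt_right (A : ArcData γ s t v w φ) :
    ∃ d : ℝ, 0 < d ∧ HasDerivWithinAt γ (d • circ v w (φ s + Real.pi / 2)) (Ici s) s := by
  obtain ⟨d, hd, h⟩ := A.hasDerivWithinAt A.left_mem
  exact ⟨d, hd, h.mono_of_mem_nhdsWithin (Icc_mem_nhdsGE A.lt)⟩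

theorem hasDerivWithinAt_left (A : ArcData γ s t v w φ) :
    ∃ d : ℝ, 0 < d ∧ HasDerivWithinAt γ (d • circ v w (φ t + Real.pi / 2)) (Iic t) t := by
  obtain ⟨d, hd, h⟩ := A.hasDerivWithinAt A.right_mem
  exact ⟨d, hd, h.mono_of_mem_nhdsWithin (Icc_mem_nhdsLE A.lt)⟩

theorem rightTan_eq (A : ArcData γ s t v w φ) :
    ∃ d : ℝ, 0 < d ∧ rightTan γ s = d • circ v w (φ s + Real.pi / 2) := by
  obtain ⟨d, hd, h⟩ := A.hasDerivWithinAt_right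
  exact ⟨d, hd, h.derivWithin (uniqueDiffWithinAt_Ici s)⟩

theorem leftTan_eq (A : ArcData γ s t v w φ) :
    ∃ d : ℝ, 0 < d ∧ leftTan γ t = d • circ v w (φ t + Real.pi / 2) := by
  obtain ⟨d, hd, h⟩ := A.hasDerivWithinAt_left
  exact ⟨d, hd, h.derivWithin (uniqueDiffWithinAt_Iic t)⟩

theorem sub (A : ArcData γ s t v w φ) {x y : ℝ} (hx : s ≤ x) (hxy : x < y) (hy : y ≤ t) :
    ArcData γ x y (circ v w (φ x)) (circ v w (φ x + Real.pi / 2)) fun z => φ z - φ x where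
  lt := hxy
  norm_left := norm_circ A.norm_left A.norm_right A.inner_eq _
  norm_right := norm_circ A.norm_left A.norm_right A.inner_eq _
  inner_eq := by
    rw [inner_circ_circ A.norm_left A.norm_right A.inner_eq, sub_add_cancel_left, Real.cos_neg,
      Real.cos_pi_div_two]
  zero := sub_self _
  lt_pi := by
    have h1 := A.strictMonoOn.monotoneOn A.left_mem (b := x) ⟨hx, hxy.le.trans hy⟩ hx
    have h2 := A.strictMonoOn.monotoneOn (a := y) ⟨hx.trans hxy.le, hy⟩ A.right_mem hy
    have h3 := A.lt_pi
    rw [A.zero] at h1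
    linarith
  deriv z hz := by
    obtain ⟨d, hd, h⟩ := A.deriv z (Icc_subset_Icc hx hy hz)
    exact ⟨d, hd, (h.mono (Icc_subset_Icc hx hy)).sub_const _⟩
  eq z hz := by
    rw [A.eq z (Icc_subset_Icc hx hy hz), circ_circ, add_sub_cancel]

theorem angle_eq (A : ArcData γ s t v w φ) {x y : ℝ} (hx : s ≤ x) (hxy : x ≤ y) (hy : y ≤ t) :
    angle (γ x) (γ y) = φ y - φ x := by
  have hx' : x ∈ Icc s t := ⟨hx, hxy.trans hy⟩
  have hy' : y ∈ Icc s t := ⟨hx.trans hxy, hy⟩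
  have h1 := A.strictMonoOn.monotoneOn A.left_mem hx' hx
  have h2 := A.strictMonoOn.monotoneOn hy' A.right_mem hy
  have h3 := A.lt_pi
  rw [A.zero] at h1
  rw [A.eq x hx', A.eq y hy', angle_circ_circ A.norm_left A.norm_right A.inner_eq
    (A.strictMonoOn.monotoneOn hx' hy' hxy) (by linarith)]

theorem chord_eq (A : ArcData γ s t v w φ) {x y : ℝ} (hx : s ≤ x) (hxy : x < y) (hy : y ≤ t) :
    ∃ d : ℝ, 0 < d ∧ γ y - γ x = d • circ v w ((φ x + φ y) / 2 + Real.pi / 2) := by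
  have hx' : x ∈ Icc s t := ⟨hx, hxy.le.trans hy⟩
  have hy' : y ∈ Icc s t := ⟨hx.trans hxy.le, hy⟩
  have h0 := A.strictMonoOn hx' hy' hxy
  have h1 := A.strictMonoOn.monotoneOn A.left_mem hx' hx
  have h2 := A.strictMonoOn.monotoneOn hy' A.right_mem hy
  have h3 := A.lt_pi
  rw [A.zero] at h1
  refine ⟨2 * Real.sin ((φ y - φ x) / 2), ?_, ?_⟩
  · have := Real.sin_pos_of_pos_of_lt_pi (x := (φ y - φ x) / 2) (by linarith) (by linarith)
    positivity
  · rw [A.eq x hx', A.eq y hy', circ_sub_circ]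

/-- The two chords are tangent directions at the mid-angles `(φ x + φ y) / 2` and `(φ y + φ z) / 2`.
-/
theorem angle_chord_chord (A : ArcData γ s t v w φ) {x y z : ℝ} (hx : s ≤ x) (hxy : x < y)
    (hyz : y < z) (hz : z ≤ t) : angle (γ y - γ x) (γ z - γ y) = (φ z - φ x) / 2 := by
  obtain ⟨d, hd, h⟩ := A.chord_eq hx hxy (hyz.le.trans hz)
  obtain ⟨e, he, h'⟩ := A.chord_eq (hx.trans hxy.le) hyz hz
  have hx' : x ∈ Icc s t := ⟨hx, hxy.le.trans (hyz.le.trans hz)⟩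
  have hz' : z ∈ Icc s t := ⟨hx.trans (hxy.le.trans hyz.le), hz⟩
  have h0 := A.strictMonoOn.monotoneOn hx' hz' (hxy.le.trans hyz.le)
  have h1 := A.strictMonoOn.monotoneOn A.left_mem hx' hx
  have h2 := A.strictMonoOn.monotoneOn hz' A.right_mem hz
  have h3 := A.lt_pi
  rw [A.zero] at h1
  rw [h, h', angle_smul_left_of_pos _ _ hd, angle_smul_right_of_pos _ _ he,
    angle_circ_circ A.norm_left A.norm_right A.inner_eq (by linarith) (by linarith)]
  ring

end ArcData

namespace IsArc

variable {N : ℕ} {γ : ℝ → Euc N} {s t : ℝ}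

theorem lt (A : IsArc γ s t) : s < t := let ⟨_, _, _, A⟩ := A; A.lt

theorem sub (A : IsArc γ s t) {x y : ℝ} (hx : s ≤ x) (hxy : x < y) (hy : y ≤ t) : IsArc γ x y :=
  let ⟨_, _, _, A⟩ := A
  ⟨_, _, _, A.sub hx hxy hy⟩

theorem congr {γ' : ℝ → Euc N} (A : IsArc γ s t) (h : ∀ x ∈ Icc s t, γ' x = γ x) :
    IsArc γ' s t :=
  let ⟨v, w, φ, A⟩ := A
  ⟨v, w, φ, { A with eq := fun x hx => (h x hx).trans (A.eq x hx) }⟩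

theorem norm_eq_one (A : IsArc γ s t) {x : ℝ} (hx : x ∈ Icc s t) : ‖γ x‖ = 1 := by
  obtain ⟨v, w, φ, A⟩ := A
  rw [A.eq x hx, norm_circ A.norm_left A.norm_right A.inner_eq]

theorem continuousOn (A : IsArc γ s t) : ContinuousOn γ (Icc s t) := by
  obtain ⟨v, w, φ, A⟩ := A
  intro x hx
  obtain ⟨d, -, h⟩ := A.hasDerivWithinAt hx
  exact h.continuousWithinAt

theorem rightTan_ne_zero (A : IsArc γ s t) : rightTan γ s ≠ 0 := by
  obtain ⟨v, w, φ, A⟩ := A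
  obtain ⟨d, hd, h⟩ := A.rightTan_eq
  rw [h]
  exact smul_ne_zero hd.ne' (circ_ne_zero A.norm_left A.norm_right A.inner_eq _)

theorem leftTan_ne_zero (A : IsArc γ s t) : leftTan γ t ≠ 0 := by
  obtain ⟨v, w, φ, A⟩ := A
  obtain ⟨d, hd, h⟩ := A.leftTan_eq
  rw [h]
  exact smul_ne_zero hd.ne' (circ_ne_zero A.norm_left A.norm_right A.inner_eq _)

theorem hasDerivWithinAt_right (A : IsArc γ s t) :
    HasDerivWithinAt γ (rightTan γ s) (Ici s) s := by
  obtain ⟨v, w, φ, A⟩ := A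
  obtain ⟨d, hd, h⟩ := A.hasDerivWithinAt_right
  exact h.differentiableWithinAt.hasDerivWithinAt

theorem hasDerivWithinAt_left (A : IsArc γ s t) :
    HasDerivWithinAt γ (leftTan γ t) (Iic t) t := by
  obtain ⟨v, w, φ, A⟩ := A
  obtain ⟨d, hd, h⟩ := A.hasDerivWithinAt_left
  exact h.differentiableWithinAt.hasDerivWithinAt

theorem inner_rightTan (A : IsArc γ s t) : ⟪γ s, rightTan γ s⟫ = 0 := by
  obtain ⟨v, w, φ, A⟩ := A
  obtain ⟨d, hd, h⟩ := A.rightTan_eq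
  rw [h, A.eq s A.left_mem, inner_smul_right,
    inner_circ_circ A.norm_left A.norm_right A.inner_eq, sub_add_cancel_left, Real.cos_neg,
      Real.cos_pi_div_two, mul_zero]

theorem inner_leftTan (A : IsArc γ s t) : ⟪γ t, leftTan γ t⟫ = 0 := by
  obtain ⟨v, w, φ, A⟩ := A
  obtain ⟨d, hd, h⟩ := A.leftTan_eq
  rw [h, A.eq t A.right_mem, inner_smul_right,
    inner_circ_circ A.norm_left A.norm_right A.inner_eq, sub_add_cancel_left, Real.cos_neg,
      Real.cos_pi_div_two, mul_zero]

theorem ne (A : IsArc γ s t) : γ s ≠ γ t := by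
  obtain ⟨v, w, φ, A⟩ := A
  obtain ⟨d, hd, h⟩ := A.chord_eq le_rfl A.lt le_rfl
  intro h0
  rw [h0, sub_self] at h
  exact smul_ne_zero hd.ne' (circ_ne_zero A.norm_left A.norm_right A.inner_eq _) h.symm

theorem angle_rightTan_chord (A : IsArc γ s t) :
    angle (rightTan γ s) (γ t - γ s) = angle (γ s) (γ t) / 2 := by
  obtain ⟨v, w, φ, A⟩ := A
  obtain ⟨d, hd, h⟩ := A.rightTan_eq
  obtain ⟨e, he, h'⟩ := A.chord_eq le_rfl A.lt le_rfl
  have h1 := A.strictMonoOn A.left_mem A.right_mem A.lt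
  have h2 := A.lt_pi
  have h3 := A.zero
  rw [h, h', angle_smul_left_of_pos _ _ hd, angle_smul_right_of_pos _ _ he,
    angle_circ_circ A.norm_left A.norm_right A.inner_eq (by linarith) (by linarith),
    A.angle_eq le_rfl A.lt.le le_rfl]
  ring

theorem angle_chord_leftTan (A : IsArc γ s t) :
    angle (γ t - γ s) (leftTan γ t) = angle (γ s) (γ t) / 2 := by
  obtain ⟨v, w, φ, A⟩ := A
  obtain ⟨d, hd, h⟩ := A.leftTan_eq
  obtain ⟨e, he, h'⟩ := A.chord_eq le_rfl A.lt le_rfl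
  have h1 := A.strictMonoOn A.left_mem A.right_mem A.lt
  have h2 := A.lt_pi
  have h3 := A.zero
  rw [h, h', angle_smul_right_of_pos _ _ hd, angle_smul_left_of_pos _ _ he,
    angle_circ_circ A.norm_left A.norm_right A.inner_eq (by linarith) (by linarith),
    A.angle_eq le_rfl A.lt.le le_rfl]
  ring

theorem turningAngle_eq_zero (A : IsArc γ s t) {x : ℝ} (hx : x ∈ Ioo s t) :
    turningAngle γ x = 0 := by
  obtain ⟨v, w, φ, A⟩ := A
  obtain ⟨d, hd, h⟩ := (A.sub le_rfl hx.1 hx.2.le).leftTan_eq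
  obtain ⟨e, he, h'⟩ := (A.sub hx.1.le hx.2 le_rfl).rightTan_eq
  rw [circ_circ] at h h'
  have e1 : φ s + (φ x - φ s + Real.pi / 2) = φ x + Real.pi / 2 := by ring
  have e2 : φ x + (φ x - φ x + Real.pi / 2) = φ x + Real.pi / 2 := by ring
  rw [e1] at h
  rw [e2] at h'
  rw [turningAngle_eq, h, h', angle_smul_left_of_pos _ _ hd, angle_smul_right_of_pos _ _ he,
    angle_self (circ_ne_zero A.norm_left A.norm_right A.inner_eq _)]

end IsArc

/-- A curve made of finitely many consecutive arcs of great circles. -/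
inductive ArcChain {N : ℕ} (γ : ℝ → Euc N) (s : ℝ) : ℝ → Prop
  | arc {t : ℝ} (h : IsArc γ s t) : ArcChain γ s t
  | append {r t : ℝ} (h : ArcChain γ s r) (h' : IsArc γ r t) : ArcChain γ s t

namespace ArcChain

variable {N : ℕ} {γ : ℝ → Euc N} {s t : ℝ}

theorem lt (h : ArcChain γ s t) : s < t := by
  induction h with
  | arc h => exact h.lt
  | append _ h' ih => exact ih.trans h'.lt

theorem trans {r : ℝ} (h : ArcChain γ s r) (h' : ArcChain γ r t) : ArcChain γ s t := by
  induction h' with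
  | arc h' => exact h.append h'
  | append _ h'' ih => exact ih.append h''

theorem congr {γ' : ℝ → Euc N} (h : ArcChain γ s t) (he : ∀ x ∈ Icc s t, γ' x = γ x) :
    ArcChain γ' s t := by
  induction h with
  | arc h => exact .arc (h.congr he)
  | append h h' ih =>
    exact (ih fun x hx => he x ⟨hx.1, hx.2.trans h'.lt.le⟩).append
      (h'.congr fun x hx => he x ⟨h.lt.le.trans hx.1, hx.2⟩)

theorem sub (h : ArcChain γ s t) {x y : ℝ} (hx : s ≤ x) (hxy : x < y) (hy : y ≤ t) :
    ArcChain γ x y := by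
  induction h generalizing x y with
  | arc h => exact .arc (h.sub hx hxy hy)
  | @append r t h h' ih =>
    rcases le_or_gt y r with hyr | hry
    · exact ih hx hxy hyr
    rcases lt_or_ge x r with hxr | hrx
    · exact (ih hx hxr le_rfl).append (h'.sub le_rfl hry hy)
    · exact .arc (h'.sub hrx hxy hy)

theorem exists_arc_right (h : ArcChain γ s t) : ∃ r, r ≤ t ∧ IsArc γ s r := by
  induction h with
  | @arc t h => exact ⟨t, le_rfl, h⟩
  | append _ h' ih => obtain ⟨r, hr, A⟩ := ih; exact ⟨r, hr.trans h'.lt.le, A⟩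

theorem exists_arc_left (h : ArcChain γ s t) : ∃ r, s ≤ r ∧ IsArc γ r t := by
  cases h with
  | arc h => exact ⟨s, le_rfl, h⟩
  | append h h' => exact ⟨_, h.lt.le, h'⟩

theorem norm_eq_one (h : ArcChain γ s t) {x : ℝ} (hx : x ∈ Icc s t) : ‖γ x‖ = 1 := by
  induction h with
  | arc h => exact h.norm_eq_one hx
  | @append r t h h' ih =>
    rcases le_total x r with hxr | hxr
    · exact ih ⟨hx.1, hxr⟩
    · exact h'.norm_eq_one ⟨hxr, hx.2⟩

theorem continuousOn (h : ArcChain γ s t) : ContinuousOn γ (Icc s t) := by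
  induction h with
  | arc h => exact h.continuousOn
  | append h h' ih =>
    rw [← Icc_union_Icc_eq_Icc h.lt.le h'.lt.le]
    exact ih.union_of_isClosed h'.continuousOn isClosed_Icc isClosed_Icc

end ArcChain

/-! ### Length -/

section curveLength

variable {X : Type*} {d : X → X → ℝ} {γ : ℝ → X} {a b c : ℝ}

theorem sum_le_curveLength (n : ℕ) {u : ℕ → ℝ} (hu : Monotone u) (hm : ∀ i, u i ∈ Icc a b) :
    ∑ i ∈ Finset.range n, ENNReal.ofReal (d (γ (u i)) (γ (u (i + 1)))) ≤ curveLength d γ a b := by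
  unfold curveLength
  exact le_iSup_of_le n (le_iSup_of_le u (le_iSup_of_le hu (le_iSup_of_le hm le_rfl)))

theorem curveLength_le {L : ℝ≥0∞} (h : ∀ (n : ℕ) (u : ℕ → ℝ), Monotone u → (∀ i, u i ∈ Icc a b) →
    ∑ i ∈ Finset.range n, ENNReal.ofReal (d (γ (u i)) (γ (u (i + 1)))) ≤ L) :
    curveLength d γ a b ≤ L :=
  iSup_le fun n => iSup_le fun u => iSup_le fun hu => iSup_le fun hm => h n u hu hm

theorem ofReal_dist_le_curveLength (hab : a ≤ b) :
    ENNReal.ofReal (d (γ a) (γ b)) ≤ curveLength d γ a b := by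
  have := sum_le_curveLength (d := d) (γ := γ) (a := a) (b := b) 1
    (u := fun i => if i = 0 then a else b)
    (by intro i j hij; show ite _ _ _ ≤ ite _ _ _; split_ifs <;> first | omega | exact le_rfl)
    (by intro i; split_ifs <;> simp [hab])
  simpa using this

/-- A single index set, so that a sum of two suprema can be bounded pair by pair. -/
theorem curveLength_eq_iSup : curveLength d γ a b =
    ⨆ q : {q : ℕ × (ℕ → ℝ) // Monotone q.2 ∧ ∀ i, q.2 i ∈ Icc a b},
      ∑ i ∈ Finset.range q.1.1, ENNReal.ofReal (d (γ (q.1.2 i)) (γ (q.1.2 (i + 1)))) :=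
  le_antisymm
    (curveLength_le fun n u hu hm => le_iSup_of_le ⟨(n, u), hu, hm⟩ le_rfl)
    (iSup_le fun q => sum_le_curveLength q.1.1 q.2.1 q.2.2)

theorem curveLength_add_le (hab : a ≤ b) (hbc : b ≤ c) :
    curveLength d γ a b + curveLength d γ b c ≤ curveLength d γ a c := by
  have : ∀ {x y : ℝ}, x ≤ y →
      Nonempty {q : ℕ × (ℕ → ℝ) // Monotone q.2 ∧ ∀ i, q.2 i ∈ Icc x y} := fun {x y} h =>
    ⟨⟨(0, fun _ => x), monotone_const, fun _ => left_mem_Icc.2 h⟩⟩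
  have h1 := this hab
  have h2 := this hbc
  rw [curveLength_eq_iSup, curveLength_eq_iSup (a := b)]
  refine ENNReal.iSup_add_iSup_le fun ⟨⟨n, u⟩, hu, hum⟩ ⟨⟨m, v⟩, hv, hvm⟩ => ?_
  dsimp only at hu hum hv hvm ⊢
  -- The two subdivisions are concatenated; the joining step from `u n` to `v 0` contributes an
  -- extra nonnegative term.
  let w : ℕ → ℝ := fun i => if i ≤ n then u i else v (i - (n + 1))
  have hw : Monotone w := by
    intro i j hij
    dsimp only [w]
    split_ifs with h1 h2 h2
    · exact hu hij
    · exact (hum i).2.trans (hvm _).1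
    · omega
    · exact hv (by omega)
  have hwm : ∀ i, w i ∈ Icc a c := by
    intro i
    dsimp only [w]
    split_ifs
    · exact ⟨(hum i).1, (hum i).2.trans hbc⟩
    · exact ⟨hab.trans (hvm _).1, (hvm _).2⟩
  refine le_trans ?_ (sum_le_curveLength (n + 1 + m) hw hwm)
  rw [Finset.sum_range_add, Finset.sum_range_succ]
  refine add_le_add (le_trans (le_of_eq (Finset.sum_congr rfl fun i hi => ?_)) le_self_add)
    (le_of_eq (Finset.sum_congr rfl fun i hi => ?_))
  · have := Finset.mem_range.1 hi
    simp only [w]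
    rw [if_pos (by omega), if_pos (by omega)]
  · simp only [w]
    rw [if_neg (by omega), if_neg (by omega)]
    congr 5 <;> omega

theorem curveLength_le_add (hd : ∀ x y, 0 ≤ d x y) (htri : ∀ x y z, d x z ≤ d x y + d y z)
    (hab : a ≤ b) (hbc : b ≤ c) :
    curveLength d γ a c ≤ curveLength d γ a b + curveLength d γ b c := by
  refine curveLength_le fun n u hu hum => ?_
  -- The subdivision is clamped to each side of `b`. Only a step straddling `b` moves in both
  -- clamped sequences, and there the triangle inequality is used.
  have h1 := sum_le_curveLength (d := d) (γ := γ) (a := a) (b := b) n (u := fun i => min (u i) b)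
    (fun i j hij => min_le_min_right _ (hu hij))
    (fun i => ⟨le_min (hum i).1 hab, min_le_right _ _⟩)
  have h2 := sum_le_curveLength (d := d) (γ := γ) (a := b) (b := c) n (u := fun i => max (u i) b)
    (fun i j hij => max_le_max_right _ (hu hij))
    (fun i => ⟨le_max_right _ _, max_le (hum i).2 hbc⟩)
  refine le_trans ?_ (add_le_add h1 h2)
  rw [← Finset.sum_add_distrib]
  refine Finset.sum_le_sum fun i _ => ?_
  rw [← ENNReal.ofReal_add (hd _ _) (hd _ _)]
  refine ENNReal.ofReal_le_ofReal ?_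
  have hi := hu (Nat.le_succ i)
  rw [Nat.succ_eq_add_one] at hi
  rcases le_total (u (i + 1)) b with h | h
  · rw [min_eq_left h, min_eq_left (hi.trans h)]
    linarith [hd (γ (max (u i) b)) (γ (max (u (i + 1)) b))]
  rcases le_total b (u i) with h' | h'
  · rw [max_eq_left h', max_eq_left h]
    linarith [hd (γ (min (u i) b)) (γ (min (u (i + 1)) b))]
  · rw [min_eq_left h', min_eq_right h, max_eq_right h', max_eq_left h]
    exact htri _ _ _

end curveLength

section length

variable {N : ℕ} {γ : ℝ → Euc N} {a b c : ℝ}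

theorem sphereLength_add (hab : a ≤ b) (hbc : b ≤ c) :
    sphereLength γ a c = sphereLength γ a b + sphereLength γ b c :=
  le_antisymm (curveLength_le_add angle_nonneg angle_le_angle_add_angle hab hbc)
    (curveLength_add_le hab hbc)

/-- Distances along an arc shorter than `π` are increments of the angle function, so the sums
telescope. -/
theorem IsArc.sphereLength_eq (A : IsArc γ a b) :
    sphereLength γ a b = ENNReal.ofReal (angle (γ a) (γ b)) := by
  refine le_antisymm (curveLength_le fun n u hu hum => ?_) (ofReal_dist_le_curveLength A.lt.le)
  obtain ⟨v, w, φ, A⟩ := A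
  rw [← ENNReal.ofReal_sum_of_nonneg fun _ _ => angle_nonneg _ _]
  refine ENNReal.ofReal_le_ofReal ?_
  rw [Finset.sum_congr rfl fun i _ => A.angle_eq (hum i).1 (hu (Nat.le_succ i)) (hum _).2]
  rw [Finset.sum_range_sub (fun i => φ (u i)), A.angle_eq le_rfl A.lt.le le_rfl]
  have h1 := A.strictMonoOn.monotoneOn A.left_mem (hum 0) (hum 0).1
  have h2 := A.strictMonoOn.monotoneOn (hum n) A.right_mem (hum n).2
  linarith

/-! ### Rotation -/

theorem rotation_add (γ : ℝ → Euc N) (hab : a < b) (hbc : b < c) :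
    rotation γ a c = rotation γ a b + ENNReal.ofReal (turningAngle γ b) + rotation γ b c := by
  unfold rotation
  have h1 : Ioo a c = Ioo a b ∪ {b} ∪ Ioo b c := by
    ext x
    simp only [mem_Ioo, mem_union, mem_singleton_iff]
    constructor
    · rintro ⟨h1, h2⟩
      rcases lt_trichotomy x b with h | h | h <;> simp [*]
    · rintro ((⟨h1, h2⟩ | rfl) | ⟨h1, h2⟩) <;> constructor <;> linarith
  have hd1 : Disjoint (Ioo a b) {b} := by simp
  have hd2 : Disjoint (Ioo a b ∪ {b}) (Ioo b c) := by
    rw [disjoint_left]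
    rintro x (⟨_, h⟩ | h) ⟨h', _⟩
    · linarith
    · rw [mem_singleton_iff] at h; linarith
  let f : ℝ → ℝ≥0∞ := fun s => ENNReal.ofReal (turningAngle γ s)
  have h2 := Summable.tsum_union_disjoint (f := f) hd2 ENNReal.summable ENNReal.summable
  have h3 := Summable.tsum_union_disjoint (f := f) hd1 ENNReal.summable ENNReal.summable
  rw [h3, tsum_singleton] at h2
  rw [h1]
  exact h2

theorem IsArc.rotation_eq_zero (A : IsArc γ a b) : rotation γ a b = 0 := by
  rw [rotation, ENNReal.tsum_eq_zero]
  intro x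
  rw [A.turningAngle_eq_zero x.2, ENNReal.ofReal_zero]

theorem ArcChain.sphereLength_ne_top (h : ArcChain γ a b) : sphereLength γ a b ≠ ∞ := by
  induction h with
  | arc h => rw [h.sphereLength_eq]; exact ENNReal.ofReal_ne_top
  | append h h' ih =>
    rw [sphereLength_add h.lt.le h'.lt.le, h'.sphereLength_eq]
    exact ENNReal.add_ne_top.2 ⟨ih, ENNReal.ofReal_ne_top⟩

theorem ArcChain.rotation_ne_top (h : ArcChain γ a b) : rotation γ a b ≠ ∞ := by
  induction h with
  | arc h => rw [h.rotation_eq_zero]; exact ENNReal.zero_ne_top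
  | append h h' ih =>
    rw [rotation_add γ h.lt h'.lt, h'.rotation_eq_zero]
    exact ENNReal.add_ne_top.2 ⟨ENNReal.add_ne_top.2 ⟨ih, ENNReal.ofReal_ne_top⟩,
      ENNReal.zero_ne_top⟩

end length

section

/-! ### Total curvature -/

variable {N : ℕ} {γ : ℝ → Euc N} {a b s t : ℝ}

/-- The sum of the length and of the geodesic rotation of a curve in the sphere. -/
def lengthRotation {N : ℕ} (γ : ℝ → Euc N) (s t : ℝ) : ℝ :=
  (sphereLength γ s t + rotation γ s t).toReal

theorem lengthRotation_nonneg (γ : ℝ → Euc N) (s t : ℝ) : 0 ≤ lengthRotation γ s t :=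
  ENNReal.toReal_nonneg

theorem turningAngle_nonneg (γ : ℝ → Euc N) (s : ℝ) : 0 ≤ turningAngle γ s := angle_nonneg _ _

theorem ArcChain.ofReal_lengthRotation (h : ArcChain γ s t) :
    ENNReal.ofReal (lengthRotation γ s t) = sphereLength γ s t + rotation γ s t :=
  ENNReal.ofReal_toReal (ENNReal.add_ne_top.2 ⟨h.sphereLength_ne_top, h.rotation_ne_top⟩)

theorem ArcChain.lengthRotation_add {r : ℝ} (h : ArcChain γ s r) (h' : ArcChain γ r t) :
    lengthRotation γ s t = lengthRotation γ s r + turningAngle γ r + lengthRotation γ r t := by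
  unfold lengthRotation
  rw [sphereLength_add h.lt.le h'.lt.le, rotation_add γ h.lt h'.lt,
    ← ENNReal.toReal_ofReal (turningAngle_nonneg γ r),
    ← ENNReal.toReal_add (by simp [h.sphereLength_ne_top, h.rotation_ne_top]) (by simp),
    ← ENNReal.toReal_add (by simp [h.sphereLength_ne_top, h.rotation_ne_top])
      (by simp [h'.sphereLength_ne_top, h'.rotation_ne_top]),
    ENNReal.toReal_ofReal (turningAngle_nonneg γ r)]
  congr 1
  ring

theorem IsArc.lengthRotation_eq (A : IsArc γ s t) :
    lengthRotation γ s t = angle (γ s) (γ t) := by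
  rw [lengthRotation, A.sphereLength_eq, A.rotation_eq_zero, add_zero,
    ENNReal.toReal_ofReal (angle_nonneg _ _)]

theorem ArcChain.lengthRotation_mono (h : ArcChain γ s t) {x y : ℝ} (hx : s ≤ x) (hxy : x < y)
    (hy : y ≤ t) : lengthRotation γ x y ≤ lengthRotation γ s t := by
  have h1 : lengthRotation γ x y ≤ lengthRotation γ s y := by
    rcases hx.eq_or_lt with rfl | hx
    · exact le_rfl
    · rw [(h.sub le_rfl hx (hxy.le.trans hy)).lengthRotation_add (h.sub hx.le hxy hy)]
      linarith [lengthRotation_nonneg γ s x, turningAngle_nonneg γ x]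
  rcases hy.eq_or_lt with rfl | hy
  · exact h1
  · rw [(h.sub le_rfl (hx.trans_lt hxy) hy.le).lengthRotation_add
      (h.sub (hx.trans hxy.le) hy le_rfl)]
    linarith [lengthRotation_nonneg γ y t, turningAngle_nonneg γ y]

/-- Gluing step for two consecutive chords `e`, `f` with end tangents `τ₁`, `τ₂` and `τ₃`, `τ₄`. The
vector `e + f` lies between `e` and `f` and splits their angle; the rest is the triangle inequality
through the tangents. The bounds between tangents serve when a chord vanishes, as the curve may
return to the same point. -/
theorem angle_chord_add_le {V : Type*} [NormedAddCommGroup V] [InnerProductSpace ℝ V]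
    {e f τ₁ τ₂ τ₃ τ₄ : V} {A B : ℝ} (hd : e + f ≠ 0)
    (he : e ≠ 0 → angle τ₁ e + angle e τ₂ ≤ A) (hA : angle τ₁ τ₂ ≤ A)
    (hf : f ≠ 0 → angle τ₃ f + angle f τ₄ ≤ B) (hB : angle τ₃ τ₄ ≤ B) :
    angle τ₁ (e + f) + angle (e + f) τ₄ ≤ A + angle τ₂ τ₃ + B := by
  by_cases he0 : e = 0
  · subst he0
    rw [zero_add] at hd ⊢
    have h1 := hf hd
    have h2 := angle_le_angle_add_angle τ₁ τ₂ f
    have h3 := angle_le_angle_add_angle τ₂ τ₃ f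
    linarith
  by_cases hf0 : f = 0
  · subst hf0
    rw [add_zero]
    have h1 := he he0
    have h2 := angle_le_angle_add_angle e τ₂ τ₄
    have h3 := angle_le_angle_add_angle τ₂ τ₃ τ₄
    linarith
  have h0 : angle e f = angle e (e + f) + angle (e + f) f :=
    angle_add_of_smul_eq hd zero_le_one zero_le_one zero_lt_one (by simp)
  have h1 := he he0
  have h2 := hf hf0
  have h3 := angle_le_angle_add_angle τ₁ e (e + f)
  have h4 := angle_le_angle_add_angle (e + f) f τ₄
  have h5 := angle_le_angle_add_angle e τ₂ f
  have h6 := angle_le_angle_add_angle τ₂ τ₃ f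
  linarith

theorem ArcChain.angle_tan_le (h : ArcChain γ s t) :
    angle (rightTan γ s) (leftTan γ t) ≤ lengthRotation γ s t := by
  have key : ∀ {x y : ℝ}, IsArc γ x y →
      angle (rightTan γ x) (leftTan γ y) ≤ lengthRotation γ x y := fun {x y} A => by
    rw [A.lengthRotation_eq]
    have := angle_le_angle_add_angle (rightTan γ x) (γ y - γ x) (leftTan γ y)
    rw [A.angle_rightTan_chord, A.angle_chord_leftTan] at this
    linarith
  induction h with
  | arc h => exact key h
  | @append r t h h' ih =>
    rw [h.lengthRotation_add (.arc h'), turningAngle_eq]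
    have h1 := angle_le_angle_add_angle (rightTan γ s) (leftTan γ r) (leftTan γ t)
    have h2 := angle_le_angle_add_angle (leftTan γ r) (rightTan γ r) (leftTan γ t)
    linarith [key h']

/-- On a single arc this is an equality, each angle being half the arc; chains follow by gluing. -/
theorem ArcChain.angle_chord_le (h : ArcChain γ s t) (hne : γ s ≠ γ t) :
    angle (rightTan γ s) (γ t - γ s) + angle (γ t - γ s) (leftTan γ t)
      ≤ lengthRotation γ s t := by
  have key : ∀ {x y : ℝ}, IsArc γ x y →
      angle (rightTan γ x) (γ y - γ x) + angle (γ y - γ x) (leftTan γ y)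
        ≤ lengthRotation γ x y := fun {x y} A => by
    rw [A.lengthRotation_eq, A.angle_rightTan_chord, A.angle_chord_leftTan]
    linarith
  induction h with
  | arc h => exact key h
  | @append r t h h' ih =>
    rw [h.lengthRotation_add (.arc h'), turningAngle_eq]
    have he : γ t - γ s = (γ r - γ s) + (γ t - γ r) := by abel
    rw [he]
    refine angle_chord_add_le ?_ (fun h0 => ih (sub_ne_zero.1 h0).symm) h.angle_tan_le
      (fun _ => key h') (ArcChain.angle_tan_le (.arc h'))
    rw [← he]
    exact sub_ne_zero.2 hne.symm

/-- The sum of the angles between consecutive segments of an inscribed polygonal curve. -/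
def polySum {N : ℕ} (γ : ℝ → Euc N) (u : ℕ → ℝ) (n : ℕ) : ℝ :=
  ∑ i ∈ Finset.range n, angle (γ (u (i + 1)) - γ (u i)) (γ (u (i + 2)) - γ (u (i + 1)))

theorem polySum_add_two_of_cyclic (γ : ℝ → Euc N) {u : ℕ → ℝ} {n : ℕ} (h0 : u (n + 2) = u 0)
    (h1 : u (n + 3) = u 1) : polySum γ u (n + 2) = polySum γ u n
      + angle (γ (u (n + 1)) - γ (u n)) (γ (u 0) - γ (u (n + 1)))
      + angle (γ (u 0) - γ (u (n + 1))) (γ (u 1) - γ (u 0)) := by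
  rw [← h0, ← h1]
  unfold polySum
  rw [Finset.sum_range_succ, Finset.sum_range_succ]

theorem lt_of_forall_lt_succ {u : ℕ → ℝ} {n : ℕ} (hu : ∀ i ≤ n, u i < u (i + 1)) :
    ∀ i ≤ n, u 0 < u (i + 1) := by
  intro i hi
  induction i with
  | zero => exact hu 0 hi
  | succ i ih => exact (ih (by omega)).trans (hu _ hi)

/-- At each vertex the angle between segments is at most the sum of three: segment to left tangent,
the turning angle, right tangent to segment. The two end angles are kept to make the induction work,
and for reuse with closed curves. -/
theorem ArcChain.polySum_le (h : ArcChain γ a b) {u : ℕ → ℝ} (n : ℕ)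
    (hu : ∀ i ≤ n, u i < u (i + 1)) (hm : ∀ i ≤ n + 1, u i ∈ Icc a b)
    (hne : ∀ i ≤ n, γ (u i) ≠ γ (u (i + 1))) :
    angle (rightTan γ (u 0)) (γ (u 1) - γ (u 0)) + polySum γ u n
      + angle (γ (u (n + 1)) - γ (u n)) (leftTan γ (u (n + 1)))
      ≤ lengthRotation γ (u 0) (u (n + 1)) := by
  induction n with
  | zero =>
    have := (h.sub (hm 0 (by omega)).1 (hu 0 le_rfl) (hm 1 (by omega)).2).angle_chord_le
      (hne 0 le_rfl)
    simpa [polySum] using this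
  | succ n ih =>
    have h1 := ih (fun i hi => hu i (by omega)) (fun i hi => hm i (by omega))
      (fun i hi => hne i (by omega))
    have c1 := h.sub (hm 0 (by omega)).1 (lt_of_forall_lt_succ hu n (by omega))
      (hm (n + 1) (by omega)).2
    have c2 := h.sub (hm (n + 1) (by omega)).1 (hu (n + 1) le_rfl) (hm (n + 1 + 1) (by omega)).2
    rw [c1.lengthRotation_add c2, turningAngle_eq]
    have h2 := c2.angle_chord_le (hne (n + 1) le_rfl)
    rw [polySum, Finset.sum_range_succ, ← polySum]
    have h3 := angle_le_angle_add_angle (γ (u (n + 1)) - γ (u n)) (leftTan γ (u (n + 1)))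
      (γ (u (n + 2)) - γ (u (n + 1)))
    have h4 := angle_le_angle_add_angle (leftTan γ (u (n + 1))) (rightTan γ (u (n + 1)))
      (γ (u (n + 2)) - γ (u (n + 1)))
    linarith

/-- The sum of the length and of the rotation is approximated by the curvature of inscribed
polygonal curves whose first and last segments are almost tangent. -/
def HasApprox {N : ℕ} (γ : ℝ → Euc N) (s t A : ℝ) : Prop :=
  ∀ ε > 0, ∃ (n : ℕ) (u : ℕ → ℝ), u 0 = s ∧ u (n + 1) = t ∧ (∀ i ≤ n, u i < u (i + 1)) ∧
    (∀ i ≤ n, γ (u i) ≠ γ (u (i + 1))) ∧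
    angle (rightTan γ s) (γ (u 1) - γ (u 0)) ≤ ε ∧
    angle (γ (u (n + 1)) - γ (u n)) (leftTan γ t) ≤ ε ∧ A - ε ≤ polySum γ u n

theorem HasApprox.append {r A B : ℝ} (h : HasApprox γ s r A) (h' : HasApprox γ r t B) :
    HasApprox γ s t (A + turningAngle γ r + B) := by
  intro ε hε
  -- There are four errors: one in each sum, and two in comparing the angle at `r` with the turning
  -- angle.
  obtain ⟨n, u, hu0, hun, hu, hune, hus, hut, huA⟩ := h (ε / 4) (by linarith)
  obtain ⟨m, v, hv0, hvm, hv, hvne, hvs, hvt, hvB⟩ := h' (ε / 4) (by linarith)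
  let w : ℕ → ℝ := fun i => if i ≤ n + 1 then u i else v (i - (n + 1))
  have hw1 : ∀ i, i ≤ n + 1 → w i = u i := fun i hi => if_pos hi
  have hw2 : ∀ i, w (n + 1 + i) = v i := by
    intro i
    rcases Nat.eq_zero_or_pos i with rfl | hi
    · rw [Nat.add_zero, hw1 _ le_rfl, hun, hv0]
    · simp only [w]
      rw [if_neg (by omega), Nat.add_sub_cancel_left]
  have hcase : ∀ i, i ≤ n + 1 + m → i ≤ n ∨ ∃ j, j ≤ m ∧ i = n + 1 + j := by
    intro i hi
    rcases Nat.lt_or_ge n i with hi' | hi'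
    · exact Or.inr ⟨i - (n + 1), by omega, by omega⟩
    · exact Or.inl hi'
  refine ⟨n + 1 + m, w, ?_, ?_, ?_, ?_, ?_, ?_, ?_⟩
  · rw [hw1 _ (by omega), hu0]
  · rw [add_assoc, hw2, hvm]
  · intro i hi
    rcases hcase i hi with hi' | ⟨j, hj, rfl⟩
    · rw [hw1 _ (by omega), hw1 _ (by omega)]; exact hu i hi'
    · rw [hw2, Nat.add_assoc (n + 1), hw2]; exact hv j hj
  · intro i hi
    rcases hcase i hi with hi' | ⟨j, hj, rfl⟩
    · rw [hw1 _ (by omega), hw1 _ (by omega)]; exact hune i hi'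
    · rw [hw2, Nat.add_assoc (n + 1), hw2]; exact hvne j hj
  · rw [hw1 _ (by omega), hw1 _ (by omega)]; linarith
  · rw [Nat.add_assoc (n + 1), hw2, hw2]; linarith
  · have e1 : polySum γ w (n + 1 + m) = polySum γ u n
        + angle (γ (u (n + 1)) - γ (u n)) (γ (v 1) - γ (v 0)) + polySum γ v m := by
      unfold polySum
      rw [Finset.sum_range_add, Finset.sum_range_succ]
      congr 1
      · congr 1
        · refine Finset.sum_congr rfl fun i hi => ?_
          have := Finset.mem_range.1 hi
          rw [hw1 _ (by omega), hw1 _ (by omega), hw1 _ (by omega)]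
        · have e : n + 2 = n + 1 + 1 := rfl
          rw [e, hw2 1, hw1 n (by omega), hw1 (n + 1) le_rfl, hun, ← hv0]
      · refine Finset.sum_congr rfl fun i _ => ?_
        rw [Nat.add_assoc (n + 1) i 1, Nat.add_assoc (n + 1) i 2, hw2, hw2, hw2]
    rw [e1, turningAngle_eq]
    have h1 := angle_le_angle_add_angle (leftTan γ r) (γ (u (n + 1)) - γ (u n)) (rightTan γ r)
    have h2 := angle_le_angle_add_angle (γ (u (n + 1)) - γ (u n)) (γ (v 1) - γ (v 0))
      (rightTan γ r)
    rw [angle_comm (leftTan γ r) (γ (u (n + 1)) - γ (u n))] at h1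
    rw [angle_comm (γ (v 1) - γ (v 0)) (rightTan γ r)] at h2
    linarith

/-- Cut into `n + 1` pieces of equal angle, an arc of angle `ℓ` has `n` interior vertices, each
turning by `ℓ / (n + 1)`. The loss and the end angles are at most `ℓ / (n + 1)`. -/
theorem IsArc.hasApprox (A : IsArc γ s t) : HasApprox γ s t (lengthRotation γ s t) := by
  intro ε hε
  rw [A.lengthRotation_eq]
  have A' := A
  obtain ⟨v, w, φ, A⟩ := A
  obtain ⟨n, hn⟩ := exists_nat_gt (Real.pi / ε)
  have hℓ : angle (γ s) (γ t) = φ t := by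
    rw [A.angle_eq le_rfl A.lt.le le_rfl, A.zero, sub_zero]
  have hℓ0 : 0 < φ t := by
    have := A.strictMonoOn A.left_mem A.right_mem A.lt
    rwa [A.zero] at this
  have hn0 : (0 : ℝ) < n + 1 := by positivity
  have hmesh : φ t / (n + 1) ≤ ε := by
    have h1 := A.lt_pi
    rw [div_lt_iff₀ hε] at hn
    rw [div_le_iff₀ hn0]
    nlinarith
  -- The speed is not constant, so the parameters come from the intermediate value theorem; beyond
  -- `n + 1` the choice is irrelevant.
  have hex : ∀ i : ℕ, ∃ x, i ≤ n + 1 → x ∈ Icc s t ∧ φ x = φ t * i / (n + 1) := by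
    intro i
    by_cases hi : i ≤ n + 1
    · have hi' : (i : ℝ) ≤ n + 1 := by exact_mod_cast hi
      have : φ t * i / (n + 1) ∈ Icc (φ s) (φ t) := by
        rw [A.zero]
        refine ⟨by positivity, ?_⟩
        rw [div_le_iff₀ hn0]
        exact mul_le_mul_of_nonneg_left hi' hℓ0.le
      obtain ⟨x, hx, hx'⟩ := intermediate_value_Icc A.lt.le A.continuousOn_angle this
      exact ⟨x, fun _ => ⟨hx, hx'⟩⟩
    · exact ⟨0, fun h => absurd h hi⟩
  choose u hu using hex
  have hinj := A.strictMonoOn.injOn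
  have hu0 : u 0 = s := by
    refine hinj (hu 0 (by omega)).1 A.left_mem ?_
    rw [(hu 0 (by omega)).2, A.zero]; simp
  have hun : u (n + 1) = t := by
    refine hinj (hu _ le_rfl).1 A.right_mem ?_
    rw [(hu _ le_rfl).2]; push_cast; field_simp
  have hlt : ∀ i ≤ n, u i < u (i + 1) := by
    intro i hi
    rw [← A.strictMonoOn.lt_iff_lt (hu i (by omega)).1 (hu (i + 1) (by omega)).1,
      (hu i (by omega)).2, (hu (i + 1) (by omega)).2]
    push_cast
    gcongr
    linarith
  have hsub : ∀ i ≤ n, IsArc γ (u i) (u (i + 1)) := fun i hi =>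
    A'.sub (hu i (by omega)).1.1 (hlt i hi) (hu (i + 1) (by omega)).1.2
  have hstep : ∀ i ≤ n, angle (γ (u i)) (γ (u (i + 1))) = φ t / (n + 1) := by
    intro i hi
    rw [A.angle_eq (hu i (by omega)).1.1 (hlt i hi).le (hu (i + 1) (by omega)).1.2,
      (hu i (by omega)).2, (hu (i + 1) (by omega)).2]
    push_cast
    ring
  have hmesh0 : 0 < φ t / (n + 1) := by positivity
  refine ⟨n, u, hu0, hun, hlt, fun i hi => (hsub i hi).ne, ?_, ?_, ?_⟩
  · have := (hsub 0 (by omega)).angle_rightTan_chord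
    rw [hstep 0 (by omega), hu0] at this
    rw [zero_add] at this
    rw [hu0, this]
    linarith
  · have := (hsub n le_rfl).angle_chord_leftTan
    rw [hstep n le_rfl, hun] at this
    rw [hun, this]
    linarith
  · have : polySum γ u n = ∑ i ∈ Finset.range n, φ t / (n + 1) := by
      refine Finset.sum_congr rfl fun i hi => ?_
      have := Finset.mem_range.1 hi
      rw [A.angle_chord_chord (hu i (by omega)).1.1 (hlt i (by omega)) (hlt (i + 1) (by omega))
        (hu (i + 1 + 1) (by omega)).1.2, (hu i (by omega)).2, (hu (i + 1 + 1) (by omega)).2]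
      push_cast
      ring
    rw [this, Finset.sum_const, Finset.card_range, nsmul_eq_mul, hℓ]
    have e : (n : ℝ) * (φ t / (n + 1)) = φ t - φ t / (n + 1) := by field_simp; ring
    rw [e]
    linarith

theorem ArcChain.hasApprox (h : ArcChain γ s t) : HasApprox γ s t (lengthRotation γ s t) := by
  induction h with
  | arc h => exact h.hasApprox
  | append h h' ih =>
    rw [h.lengthRotation_add (.arc h')]
    exact ih.append h'.hasApprox

theorem ofReal_polySum (γ : ℝ → Euc N) (u : ℕ → ℝ) (n : ℕ) : ENNReal.ofReal (polySum γ u n) =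
    ∑ i ∈ Finset.range n, ENNReal.ofReal (angle (γ (u (i + 1)) - γ (u i))
      (γ (u (i + 2)) - γ (u (i + 1)))) :=
  ENNReal.ofReal_sum_of_nonneg fun _ _ => angle_nonneg _ _

theorem mem_Icc_of_forall_lt_succ {u : ℕ → ℝ} {n : ℕ} (hu : ∀ i ≤ n, u i < u (i + 1)) :
    ∀ i ≤ n + 1, u i ∈ Icc (u 0) (u (n + 1)) := by
  have hmono : MonotoneOn u (Icc 0 (n + 1)) := by
    refine monotoneOn_of_le_succ ordConnected_Icc fun i _ _ hi => ?_
    rw [Nat.succ_eq_succ] at hi ⊢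
    have : i + 1 ≤ n + 1 := hi.2
    exact (hu i (by omega)).le
  intro i hi
  exact ⟨hmono ⟨le_rfl, Nat.zero_le _⟩ ⟨Nat.zero_le _, hi⟩ (Nat.zero_le _),
    hmono ⟨Nat.zero_le _, hi⟩ ⟨Nat.zero_le _, le_rfl⟩ hi⟩

theorem ofReal_polySum_le_totalCurvature {u : ℕ → ℝ} {n : ℕ}
    (hu : ∀ i ≤ n, u i < u (i + 1)) (hne : ∀ i ≤ n, γ (u i) ≠ γ (u (i + 1))) :
    ENNReal.ofReal (polySum γ u n) ≤ totalCurvature γ (u 0) (u (n + 1)) := by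
  -- `totalCurvature` asks for a globally strictly monotone sequence, so the finite one is continued
  -- by unit steps that play no role.
  let w : ℕ → ℝ := fun i => if i ≤ n + 1 then u i else u (n + 1) + (i - (n + 1) : ℝ)
  have hw1 : ∀ i, i ≤ n + 1 → w i = u i := fun i hi => if_pos hi
  have hw : StrictMono w := by
    refine strictMono_nat_of_lt_succ fun i => ?_
    rcases lt_trichotomy i (n + 1) with hi | rfl | hi
    · rw [hw1 _ (by omega), hw1 _ (by omega)]; exact hu i (by omega)
    · rw [hw1 _ le_rfl]
      simp only [w]
      rw [if_neg (by omega)]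
      push_cast
      linarith
    · simp only [w]
      rw [if_neg (by omega), if_neg (by omega)]
      push_cast
      linarith
  have e : polySum γ u n = polySum γ w n := by
    refine Finset.sum_congr rfl fun i hi => ?_
    have := Finset.mem_range.1 hi
    rw [hw1 _ (by omega), hw1 _ (by omega), hw1 _ (by omega)]
  rw [e, ofReal_polySum]
  unfold totalCurvature
  refine le_iSup_of_le n (le_iSup_of_le w (le_iSup_of_le hw (le_iSup_of_le ?_
    (le_iSup_of_le ?_ le_rfl))))
  · intro i hi
    rw [hw1 i hi]
    exact mem_Icc_of_forall_lt_succ hu i hi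
  · intro i hi
    rw [hw1 i (by omega), hw1 (i + 1) (by omega)]
    exact hne i hi

theorem ArcChain.totalCurvature_eq (h : ArcChain γ a b) :
    totalCurvature γ a b = sphereLength γ a b + rotation γ a b := by
  rw [← h.ofReal_lengthRotation]
  refine le_antisymm ?_ ?_
  · refine iSup_le fun n => iSup_le fun u => iSup_le fun hu => iSup_le fun hm =>
      iSup_le fun hne => ?_
    rw [← ofReal_polySum]
    refine ENNReal.ofReal_le_ofReal ?_
    have h1 := h.polySum_le n (fun i _ => hu (Nat.lt_succ_self i)) hm hne
    have h2 := h.lengthRotation_mono (hm 0 (by omega)).1 (hu (Nat.succ_pos n)) (hm _ le_rfl).2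
    have h3 := angle_nonneg (rightTan γ (u 0)) (γ (u 1) - γ (u 0))
    have h4 := angle_nonneg (γ (u (n + 1)) - γ (u n)) (leftTan γ (u (n + 1)))
    rw [Nat.succ_eq_add_one] at h2
    linarith
  · refine ENNReal.le_of_forall_pos_le_add fun ε hε _ => ?_
    obtain ⟨n, u, hu0, hun, hu, hne, -, -, hA⟩ := h.hasApprox ε (by exact_mod_cast hε)
    have h1 := ofReal_polySum_le_totalCurvature hu hne
    rw [hu0, hun] at h1
    refine le_trans (ENNReal.ofReal_le_ofReal (sub_le_iff_le_add.1 hA)) ?_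
    refine ENNReal.ofReal_add_le.trans (add_le_add h1 ?_)
    simp

/-! ### Closed curves -/

theorem finOfNat_succ (n i : ℕ) : Fin.ofNat (n + 2) (i + 1) = Fin.ofNat (n + 2) i + 1 := by
  ext
  simp [Fin.val_add, Fin.ofNat]

/-- Unrolls the cyclic indices into a periodic sequence, to which the estimates for open curves
apply. -/
theorem closedTotalCurvature_sum_eq {n : ℕ} (γ : ℝ → Euc N) (u : Fin (n + 2) → ℝ) :
    ∑ i, ENNReal.ofReal (angle (γ (u (i + 1)) - γ (u i)) (γ (u (i + 1 + 1)) - γ (u (i + 1))))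
      = ENNReal.ofReal (polySum γ (fun i => u (Fin.ofNat (n + 2) i)) (n + 2)) := by
  rw [ofReal_polySum, Finset.sum_range]
  refine Finset.sum_congr rfl fun i _ => ?_
  have e : (i : ℕ) + 2 = i + 1 + 1 := rfl
  rw [e, finOfNat_succ, finOfNat_succ, finOfNat_succ, Fin.ofNat_val_eq_self]

theorem closingAngle_eq (hab : γ a = γ b) (h1 : ‖γ b‖ = 1) :
    closingAngle γ a b = angle (leftTan γ b) (rightTan γ a) := by
  rw [closingAngle, hab, real_inner_self_eq_norm_sq, h1, one_pow, one_smul]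
  rfl

/-- The closing segment spans the end of the curve followed by its beginning. It is bounded by the
same gluing step, with the turning angle at the base point as the middle term. -/
theorem ArcChain.closed_polySum_le (h : ArcChain γ a b) (hab : γ a = γ b) {u : ℕ → ℝ} (n : ℕ)
    (hu : ∀ i ≤ n, u i < u (i + 1)) (hm : ∀ i ≤ n + 1, u i ∈ Ico a b)
    (hne : ∀ i ≤ n, γ (u i) ≠ γ (u (i + 1))) (hne' : γ (u (n + 1)) ≠ γ (u 0)) :
    polySum γ u n
      + angle (γ (u (n + 1)) - γ (u n)) (γ (u 0) - γ (u (n + 1)))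
      + angle (γ (u 0) - γ (u (n + 1))) (γ (u 1) - γ (u 0))
      ≤ lengthRotation γ a b + angle (leftTan γ b) (rightTan γ a) := by
  have hm' : ∀ i ≤ n + 1, u i ∈ Icc a b := fun i hi => Ico_subset_Icc_self (hm i hi)
  have h0 := h.polySum_le n hu hm' hne
  have hlt := lt_of_forall_lt_succ hu n le_rfl
  have c1 := h.sub (hm' 0 (by omega)).1 hlt (hm' (n + 1) le_rfl).2
  have c2 := h.sub (hm' (n + 1) le_rfl).1 (hm (n + 1) le_rfl).2 le_rfl
  have e12 := c1.lengthRotation_add c2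
  have t1 := angle_le_angle_add_angle (γ (u (n + 1)) - γ (u n)) (leftTan γ (u (n + 1)))
    (γ (u 0) - γ (u (n + 1)))
  have t2 := angle_le_angle_add_angle (leftTan γ (u (n + 1))) (rightTan γ (u (n + 1)))
    (γ (u 0) - γ (u (n + 1)))
  rw [turningAngle_eq] at e12
  -- If the first vertex is the base point there is no initial piece, and the closing segment is a
  -- chord of the last piece alone.
  rcases (hm' 0 (by omega)).1.eq_or_lt with ha | ha
  · have h3 := c2.angle_chord_le (by rw [← hab, ha]; exact hne')
    rw [← hab, ha] at h3
    rw [ha]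
    have t3 := angle_le_angle_add_angle (γ (u 0) - γ (u (n + 1))) (leftTan γ b)
      (γ (u 1) - γ (u 0))
    have t4 := angle_le_angle_add_angle (leftTan γ b) (rightTan γ (u 0)) (γ (u 1) - γ (u 0))
    linarith
  · have c0 := h.sub le_rfl ha (hm' 0 (by omega)).2
    have e0 := c0.lengthRotation_add (c1.trans c2)
    rw [turningAngle_eq] at e0
    have hsplit : γ (u 0) - γ (u (n + 1)) = (γ b - γ (u (n + 1))) + (γ (u 0) - γ a) := by
      rw [hab]; abel
    have h3 : angle (rightTan γ (u (n + 1))) (γ (u 0) - γ (u (n + 1)))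
        + angle (γ (u 0) - γ (u (n + 1))) (leftTan γ (u 0))
        ≤ lengthRotation γ (u (n + 1)) b + angle (leftTan γ b) (rightTan γ a)
          + lengthRotation γ a (u 0) := by
      rw [hsplit]
      refine angle_chord_add_le ?_ (fun h0 => c2.angle_chord_le (sub_ne_zero.1 h0).symm)
        c2.angle_tan_le (fun h0 => c0.angle_chord_le (sub_ne_zero.1 h0).symm) c0.angle_tan_le
      rw [← hsplit]
      exact sub_ne_zero.2 hne'.symm
    have t3 := angle_le_angle_add_angle (γ (u 0) - γ (u (n + 1))) (leftTan γ (u 0))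
      (γ (u 1) - γ (u 0))
    have t4 := angle_le_angle_add_angle (leftTan γ (u 0)) (rightTan γ (u 0)) (γ (u 1) - γ (u 0))
    linarith

theorem ArcChain.closedTotalCurvature_eq (h : ArcChain γ a b) (hab : γ a = γ b) :
    closedTotalCurvature γ a b = sphereLength γ a b + closedRotation γ a b := by
  rw [closedRotation, ← add_assoc, ← h.ofReal_lengthRotation,
    ← ENNReal.ofReal_add (lengthRotation_nonneg _ _ _) (show 0 ≤ closingAngle γ a b from angle_nonneg _ _)]
  rw [closingAngle_eq hab (h.norm_eq_one (right_mem_Icc.2 h.lt.le))]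
  refine le_antisymm ?_ ?_
  · refine iSup_le fun n => iSup_le fun u => iSup_le fun hu => iSup_le fun hm =>
      iSup_le fun hne => ?_
    rw [closedTotalCurvature_sum_eq]
    refine ENNReal.ofReal_le_ofReal ?_
    have hval : ∀ i, i ≤ n + 1 → (Fin.ofNat (n + 2) i).val = i := fun i hi => by
      simp [Fin.ofNat, Nat.mod_eq_of_lt (show i < n + 2 by omega)]
    have e0 : Fin.ofNat (n + 2) (n + 2) = Fin.ofNat (n + 2) 0 := by ext; simp [Fin.ofNat]
    have e1 : Fin.ofNat (n + 2) (n + 2 + 1) = Fin.ofNat (n + 2) 1 := by ext; simp [Fin.ofNat]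
    have h1 := h.closed_polySum_le hab (u := fun i => u (Fin.ofNat (n + 2) i)) n
      (fun i hi => hu (by rw [Fin.lt_def, hval i (by omega), hval (i + 1) (by omega)]; omega))
      (fun i _ => hm _)
      (fun i _ => by rw [finOfNat_succ]; exact hne _)
      (by
        have := hne (Fin.ofNat (n + 2) (n + 1))
        rwa [← finOfNat_succ, e0] at this)
    rw [polySum_add_two_of_cyclic γ (congrArg u e0) (congrArg u e1)]
    exact h1
  · refine ENNReal.le_of_forall_pos_le_add fun ε hε _ => ?_
    obtain ⟨n, u, hu0, hun, hu, hne, hfst, hlst, hA⟩ := h.hasApprox (ε / 3) (by positivity)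
    -- A single segment would join the coinciding points `γ a` and `γ b`.
    obtain ⟨n, rfl⟩ : ∃ m, n = m + 1 := by
      rcases n with _ | m
      · have := hne 0 le_rfl
        rw [hu0, hun] at this
        exact absurd hab this
      · exact ⟨m, rfl⟩
    have hmem := mem_Icc_of_forall_lt_succ hu
    -- The last vertex `b` is dropped: it gives the same point as `a`, and the cyclic indices return
    -- there.
    have hu' : StrictMono fun i : Fin (n + 2) => u i := by
      refine Fin.strictMono_iff_lt_succ.2 fun i => ?_
      simpa using hu i (by omega)
    have hγ : ∀ i, i ≤ n + 2 → γ (u (Fin.ofNat (n + 2) i)) = γ (u i) := by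
      intro i hi
      rcases hi.lt_or_eq with hi | rfl
      · simp [Fin.ofNat, Nat.mod_eq_of_lt hi]
      · simp only [Fin.ofNat, Nat.mod_self]
        rw [hu0, hun, hab]
    have e1 : Fin.ofNat (n + 2) (n + 2 + 1) = Fin.ofNat (n + 2) 1 := by ext; simp [Fin.ofNat]
    have e3 : n + 1 + 2 = n + 2 + 1 := rfl
    -- Closing up adds one angle, at the base point, which is within `2 * ε / 3` of the closing
    -- angle because the end segments are almost tangent.
    have hsum : polySum γ (fun i => u (Fin.ofNat (n + 2) i)) (n + 2) = polySum γ u (n + 1)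
        + angle (γ (u (n + 2)) - γ (u (n + 1))) (γ (u 1) - γ (u 0)) := by
      rw [polySum, Finset.sum_range_succ]
      congr 1
      · refine Finset.sum_congr rfl fun i hi => ?_
        have := Finset.mem_range.1 hi
        rw [hγ _ (by omega), hγ _ (by omega), hγ _ (by omega)]
      · have h1 := hγ (n + 1 + 1) (by omega)
        have h2 := hγ (n + 1) (by omega)
        have h3 := hγ 1 (by omega)
        rw [← e1] at h3
        rw [h1, h2, e3, h3, hu0, hab, ← hun]
    have hle : ENNReal.ofReal (polySum γ (fun i => u (Fin.ofNat (n + 2) i)) (n + 2))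
        ≤ closedTotalCurvature γ a b := by
      rw [← closedTotalCurvature_sum_eq γ fun i : Fin (n + 2) => u i]
      unfold closedTotalCurvature
      refine le_iSup_of_le n (le_iSup_of_le _ (le_iSup_of_le hu' (le_iSup_of_le ?_
        (le_iSup_of_le ?_ le_rfl))))
      · intro i
        have h1 := hmem i (by omega)
        rw [hu0] at h1
        refine ⟨h1.1, ?_⟩
        have h2 := lt_of_lt_of_le (hu i (by omega)) (hmem (i + 1) (by omega)).2
        rwa [hun] at h2
      · intro i
        have h1 := hne i (by omega)
        have h2 := hγ (i + 1) (by omega)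
        rw [finOfNat_succ, Fin.ofNat_val_eq_self] at h2
        rw [h2]
        exact h1
    refine le_trans ?_ (add_le_add_left hle _)
    have hb : (0 : ℝ) ≤ polySum γ (fun i => u (Fin.ofNat (n + 2) i)) (n + 2) :=
      Finset.sum_nonneg fun _ _ => angle_nonneg _ _
    rw [← ENNReal.ofReal_coe_nnreal, ← ENNReal.ofReal_add hb ε.coe_nonneg]
    refine ENNReal.ofReal_le_ofReal ?_
    rw [hsum]
    have t1 := angle_le_angle_add_angle (leftTan γ b) (γ (u (n + 2)) - γ (u (n + 1)))
      (rightTan γ a)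
    have t2 := angle_le_angle_add_angle (γ (u (n + 2)) - γ (u (n + 1))) (γ (u 1) - γ (u 0))
      (rightTan γ a)
    rw [angle_comm (leftTan γ b) (γ (u (n + 2)) - γ (u (n + 1)))] at t1
    rw [angle_comm (γ (u 1) - γ (u 0)) (rightTan γ a)] at t2
    have e4 : n + 1 + 1 = n + 2 := rfl
    rw [e4] at hlst
    linarith

end

/-! ### Projections of arcs -/

section projection

variable {N : ℕ} {γ : ℝ → Euc N} {a b s t : ℝ}

/-- Normalizing removes the radial component of the derivative, which is exactly what `tang` does.
-/
theorem hasDerivWithinAt_normalize {f : ℝ → Euc N} {f' : Euc N} {S : Set ℝ} {x : ℝ}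
    (hf : HasDerivWithinAt f f' S x) (h0 : f x ≠ 0) :
    HasDerivWithinAt (fun y => ‖f y‖⁻¹ • f y)
      (‖f x‖⁻¹ • (f' - (⟪f x, f'⟫ / ‖f x‖ ^ 2) • f x)) S x := by
  have hn : ‖f x‖ ≠ 0 := norm_ne_zero_iff.2 h0
  have h1 : HasDerivWithinAt (fun y => ‖f y‖ ^ 2) (2 * ⟪f x, f'⟫) S x := hf.norm_sq
  have h2 := h1.sqrt (by positivity)
  simp only [Real.sqrt_sq (norm_nonneg _)] at h2
  have h3 := (h2.fun_inv hn).smul hf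
  refine h3.congr_deriv ?_
  rw [smul_sub, smul_smul, sub_eq_add_neg, ← neg_smul]
  congr 2
  field_simp

/-- In the orthonormal basis `v'`, `w'` obtained from `L v`, `L w` by Gram–Schmidt, the image of the
half circle is a curve `z` in the complex plane. It starts on the positive real axis and stays in
the upper half plane for angles in `(0, π)`, so its argument is the new angle function, with values
below `π`. -/
theorem ArcData.proj {v w : Euc N} {φ : ℝ → ℝ} (A : ArcData γ s t v w φ)
    (L : Euc N →L[ℝ] Euc N) (hv : L v ≠ 0) (hw : tang L v w ≠ 0) :
    (∀ x ∈ Icc s t, L (γ x) ≠ 0) ∧ IsArc (fun x => ‖L (γ x)‖⁻¹ • L (γ x)) s t := by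
  set r := ‖L v‖
  set q := ‖tang L v w‖
  have hr : 0 < r := norm_pos_iff.2 hv
  have hq : 0 < q := norm_pos_iff.2 hw
  set α := ⟪L v, L w⟫ / r
  set v' := r⁻¹ • L v with hv'
  set w' := q⁻¹ • tang L v w with hw'
  have nv : ‖v'‖ = 1 := norm_smul_inv_norm hv
  have nw : ‖w'‖ = 1 := norm_smul_inv_norm hw
  have hvw : ⟪v', w'⟫ = 0 := by
    simp only [v', w', tang_apply, inner_smul_left, inner_smul_right, inner_sub_right,
      real_inner_self_eq_norm_sq, conj_trivial]
    field_simp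
    ring
  have hLv : L v = r • v' := by rw [hv', smul_inv_smul₀ hr.ne']
  have hLw : L w = α • v' + q • w' := by
    rw [hw', smul_inv_smul₀ hq.ne', hv', smul_smul, tang_apply]
    have : α * r⁻¹ = ⟪L v, L w⟫ / ‖L v‖ ^ 2 := by
      simp only [α, r]; field_simp
    rw [this]; abel
  let z : ℝ → ℂ := fun θ => ⟨Real.cos θ * r + Real.sin θ * α, q * Real.sin θ⟩
  have hLcirc : ∀ θ, L (circ v w θ) = (z θ).re • v' + (z θ).im • w' := by
    intro θ
    simp only [circ, map_add, map_smul, hLv, hLw, z]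
    module
  have hslit : ∀ x ∈ Icc s t, z (φ x) ∈ Complex.slitPlane := by
    intro x hx
    have h1 := A.strictMonoOn.monotoneOn A.left_mem hx hx.1
    have h2 := A.strictMonoOn.monotoneOn hx A.right_mem hx.2
    have h3 := A.lt_pi
    rw [A.zero] at h1
    rcases h1.eq_or_lt with h0 | h0
    · left
      simp only [z, ← h0, Real.cos_zero, Real.sin_zero]
      simpa using hr
    · right
      have := Real.sin_pos_of_pos_of_lt_pi h0 (by linarith)
      exact (mul_pos hq this).ne'
  have hz0 : ∀ x ∈ Icc s t, z (φ x) ≠ 0 := fun x hx => Complex.slitPlane_ne_zero (hslit x hx)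
  have hnorm : ∀ θ, ‖L (circ v w θ)‖ = ‖z θ‖ := by
    intro θ
    have h1 : ‖L (circ v w θ)‖ ^ 2 = ‖z θ‖ ^ 2 := by
      have hwv : ⟪w', v'⟫ = 0 := by rw [real_inner_comm, hvw]
      rw [← real_inner_self_eq_norm_sq, hLcirc, ← Complex.normSq_eq_norm_sq, Complex.normSq_apply]
      simp only [inner_add_left, inner_add_right, inner_smul_left, inner_smul_right, hvw, hwv,
        real_inner_self_eq_norm_sq, nv, nw]
      simp
    exact (sq_eq_sq₀ (norm_nonneg _) (norm_nonneg _)).1 h1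
  refine ⟨fun x hx => ?_, v', w', fun x => (z (φ x)).arg, A.lt, nv, nw, hvw, ?_, ?_, ?_, ?_⟩
  · rw [A.eq x hx, ← norm_ne_zero_iff, hnorm]
    exact norm_ne_zero_iff.2 (hz0 x hx)
  · have : z (φ s) = (r : ℂ) := by
      rw [A.zero]
      apply Complex.ext <;> simp [z]
    simp only [this]
    exact Complex.arg_ofReal_of_nonneg hr.le
  · exact lt_of_le_of_ne (Complex.arg_le_pi _)
      (Complex.mem_slitPlane_iff_arg.1 (hslit t A.right_mem)).1
  · intro x hx
    obtain ⟨d, hd, h⟩ := A.deriv x hx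
    have hre : HasDerivWithinAt (fun y => Real.cos (φ y) * r + Real.sin (φ y) * α)
        (-Real.sin (φ x) * d * r + Real.cos (φ x) * d * α) (Icc s t) x :=
      (h.cos.mul_const r).add (h.sin.mul_const α)
    have him : HasDerivWithinAt (fun y => q * Real.sin (φ y))
        (q * (Real.cos (φ x) * d)) (Icc s t) x := h.sin.const_mul q
    have hz : HasDerivWithinAt (fun y => z (φ y))
        ((-Real.sin (φ x) * d * r + Real.cos (φ x) * d * α : ℝ)
          + (q * (Real.cos (φ x) * d) : ℝ) * Complex.I : ℂ) (Icc s t) x := by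
      have := hre.ofReal_comp.add (him.ofReal_comp.mul_const Complex.I)
      refine this.congr_of_mem (fun y _ => ?_) hx
      simp only [z, Pi.add_apply]
      generalize Real.cos (φ y) = C
      generalize Real.sin (φ y) = S
      apply Complex.ext <;> simp
    -- The argument is the imaginary part of the logarithm. Its derivative is `d * q * r` divided by
    -- the squared norm of `z`, hence positive.
    have hlog := Complex.imCLM.hasFDerivAt.comp_hasDerivWithinAt x (hz.clog_real (hslit x hx))
    refine ⟨_, ?_, hlog.congr_of_mem (fun y _ => by simp [Complex.log_im]) hx⟩
    have hn : 0 < Complex.normSq (z (φ x)) := Complex.normSq_pos.2 (hz0 x hx)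
    have e : Real.sin (φ x) ^ 2 + Real.cos (φ x) ^ 2 = 1 := Real.sin_sq_add_cos_sq _
    rw [Complex.imCLM_apply, Complex.div_im, ← sub_div]
    refine div_pos ?_ hn
    have : 0 < d * q * r := by positivity
    simp only [z]
    generalize Real.cos (φ x) = C at e
    generalize Real.sin (φ x) = S at e
    simp
    linear_combination this - d * q * r * e
  · intro x hx
    have h0 := hz0 x hx
    simp only [A.eq x hx]
    rw [hnorm, hLcirc, circ, Complex.cos_arg h0, Complex.sin_arg, smul_add]
    simp only [div_eq_inv_mul, mul_smul]

/-- Almost every projection maps an arc of a great circle to an arc of a great circle. -/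
theorem IsArc.ae_proj {k : ℕ} (h : k ≤ N + 1) (hk : 2 ≤ k) (A : IsArc γ s t) :
    ∀ᵐ p ∂grMeasure N k h, (∀ x ∈ Icc s t, p.proj (γ x) ≠ 0) ∧ IsArc (sphereProj p ∘ γ) s t := by
  obtain ⟨v, w, φ, A⟩ := A
  have hv : v ≠ 0 := by rw [← norm_ne_zero_iff, A.norm_left]; exact one_ne_zero
  have hw : w ≠ 0 := by rw [← norm_ne_zero_iff, A.norm_right]; exact one_ne_zero
  -- Base point `0` gives `L v ≠ 0`; base point `v` gives independence of `L v` and `L w`.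
  filter_upwards [ae_tang_ne_zero h hk (inner_zero_left v) hv,
    ae_tang_ne_zero h hk A.inner_eq hw] with p h1 h2
  rw [tang_zero_left] at h1
  exact A.proj p.proj h1 h2

theorem ArcChain.ae_proj {k : ℕ} (h : k ≤ N + 1) (hk : 2 ≤ k) (A : ArcChain γ s t) :
    ∀ᵐ p ∂grMeasure N k h, (∀ x ∈ Icc s t, p.proj (γ x) ≠ 0) ∧
      ArcChain (sphereProj p ∘ γ) s t := by
  induction A with
  | arc A =>
    filter_upwards [A.ae_proj h hk] with p hp
    exact ⟨hp.1, .arc hp.2⟩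
  | @append r t A A' ih =>
    filter_upwards [ih, A'.ae_proj h hk] with p h1 h2
    refine ⟨fun x hx => ?_, h1.2.append h2.2⟩
    rcases le_total x r with hxr | hxr
    · exact h1.1 x ⟨hx.1, hxr⟩
    · exact h2.1 x ⟨hxr, hx.2⟩

theorem IsArc.rightTan_proj {k : ℕ} (A : IsArc γ s t) {p : Gr N k} (hp : p.proj (γ s) ≠ 0) :
    rightTan (sphereProj p ∘ γ) s = ‖p.proj (γ s)‖⁻¹ • tang p.proj (γ s) (rightTan γ s) :=
  (hasDerivWithinAt_normalize (p.proj.hasFDerivAt.comp_hasDerivWithinAt s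
    A.hasDerivWithinAt_right) hp).derivWithin (uniqueDiffWithinAt_Ici s)

theorem IsArc.leftTan_proj {k : ℕ} (A : IsArc γ s t) {p : Gr N k} (hp : p.proj (γ t) ≠ 0) :
    leftTan (sphereProj p ∘ γ) t = ‖p.proj (γ t)‖⁻¹ • tang p.proj (γ t) (leftTan γ t) :=
  (hasDerivWithinAt_normalize (p.proj.hasFDerivAt.comp_hasDerivWithinAt t
    A.hasDerivWithinAt_left) hp).derivWithin (uniqueDiffWithinAt_Iic t)

/-! ### Averages over the Grassmannian -/

section IsAverage

variable {Ω : Type*} [MeasurableSpace Ω] {μ : Measure Ω} {q q' : ℝ≥0∞} {F F' : Ω → ℝ≥0∞}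

theorem IsAverage.congr (h : IsAverage μ q F) (hF : F' =ᵐ[μ] F) : IsAverage μ q F' :=
  ⟨h.1, h.2.1.congr hF.symm, by rw [lintegral_congr_ae hF]; exact h.2.2⟩

theorem IsAverage.add (h : IsAverage μ q F) (h' : IsAverage μ q' F') :
    IsAverage μ (q + q') fun p => F p + F' p :=
  ⟨ENNReal.add_ne_top.2 ⟨h.1, h'.1⟩, h.2.1.add h'.2.1, by
    rw [lintegral_add_left' h.2.1, ← h.2.2, ← h'.2.2]⟩

end IsAverage

theorem isAverage_angle_tang {k : ℕ} (h : k ≤ N + 1) (hk : 2 ≤ k) {x y z : Euc N}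
    (hxy : ⟪x, y⟫ = 0) (hxz : ⟪x, z⟫ = 0) (hy : y ≠ 0) (hz : z ≠ 0) :
    IsAverage (grMeasure N k h) (ENNReal.ofReal (angle y z))
      fun p => ENNReal.ofReal (angle (tang p.proj x y) (tang p.proj x z)) :=
  ⟨ENNReal.ofReal_ne_top,
    (measurable_angle (measurable_tang x y) (measurable_tang x z)).ennreal_ofReal.aemeasurable,
    (lintegral_angle_tang h hk hxy hxz hy hz).symm⟩

theorem IsArc.isAverage_sphereLength {k : ℕ} (h : k ≤ N + 1) (hk : 2 ≤ k) (A : IsArc γ s t) :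
    IsAverage (grMeasure N k h) (sphereLength γ s t)
      fun p => sphereLength (sphereProj p ∘ γ) s t := by
  have hne : ∀ x ∈ Icc s t, γ x ≠ 0 := fun x hx => by
    rw [← norm_ne_zero_iff, A.norm_eq_one hx]; exact one_ne_zero
  rw [A.sphereLength_eq]
  refine (isAverage_angle_tang h hk (inner_zero_left _) (inner_zero_left _)
    (hne s (left_mem_Icc.2 A.lt.le)) (hne t (right_mem_Icc.2 A.lt.le))).congr ?_
  filter_upwards [A.ae_proj h hk] with p hp
  have h1 := norm_pos_iff.2 (hp.1 s (left_mem_Icc.2 A.lt.le))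
  have h2 := norm_pos_iff.2 (hp.1 t (right_mem_Icc.2 A.lt.le))
  rw [hp.2.sphereLength_eq, tang_zero_left, tang_zero_left]
  simp only [Function.comp, sphereProj]
  rw [angle_smul_left_of_pos _ _ (inv_pos.2 h1), angle_smul_right_of_pos _ _ (inv_pos.2 h2)]

/-- Taking `a = b` and `σ = 1` gives interior vertices; other choices give base points of closed
curves, and `σ = -1` lifts that close up to sign. The sign is harmless because `tang` does not
change when its base point is negated. -/
theorem isAverage_angle_leftTan_rightTan {k : ℕ} (h : k ≤ N + 1) (hk : 2 ≤ k) {x y σ : ℝ}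
    (A : IsArc γ x b) (A' : IsArc γ a y) (hσ : σ = 1 ∨ σ = -1) (hab : γ b = σ • γ a) :
    IsAverage (grMeasure N k h) (ENNReal.ofReal (angle (leftTan γ b) (σ • rightTan γ a)))
      fun p => ENNReal.ofReal (angle (leftTan (sphereProj p ∘ γ) b)
        (σ • rightTan (sphereProj p ∘ γ) a)) := by
  have hσ0 : σ ≠ 0 := by rcases hσ with rfl | rfl <;> norm_num
  have htang : ∀ L : Euc N →L[ℝ] Euc N, tang L (γ b) = tang L (γ a) := fun L => by
    ext1 z
    rcases hσ with rfl | rfl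
    · rw [hab, one_smul]
    · rw [hab, neg_one_smul, tang_neg_left]
  have hinner : ⟪γ a, leftTan γ b⟫ = 0 := by
    have := A.inner_leftTan
    rw [hab, inner_smul_left] at this
    exact (mul_eq_zero.1 this).resolve_left hσ0
  refine (isAverage_angle_tang h hk (x := γ a) (y := leftTan γ b) (z := σ • rightTan γ a) hinner
    (by rw [inner_smul_right, A'.inner_rightTan, mul_zero]) A.leftTan_ne_zero
    (smul_ne_zero hσ0 A'.rightTan_ne_zero)).congr ?_
  filter_upwards [A.ae_proj h hk, A'.ae_proj h hk] with p h1 h2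
  have h1' := h1.1 b (right_mem_Icc.2 A.lt.le)
  have h2' := h2.1 a (left_mem_Icc.2 A'.lt.le)
  rw [A.leftTan_proj h1', A'.rightTan_proj h2', smul_comm,
    angle_smul_left_of_pos _ _ (inv_pos.2 (norm_pos_iff.2 h1')),
    angle_smul_right_of_pos _ _ (inv_pos.2 (norm_pos_iff.2 h2')), htang, map_smul]

theorem ArcChain.isAverage_sphereLength {k : ℕ} (h : k ≤ N + 1) (hk : 2 ≤ k)
    (A : ArcChain γ s t) : IsAverage (grMeasure N k h) (sphereLength γ s t)
      fun p => sphereLength (sphereProj p ∘ γ) s t := by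
  induction A with
  | arc A => exact A.isAverage_sphereLength h hk
  | append A A' ih =>
    have := ih.add (A'.isAverage_sphereLength h hk)
    rw [← sphereLength_add A.lt.le A'.lt.le] at this
    exact this.congr (Filter.Eventually.of_forall fun p => sphereLength_add A.lt.le A'.lt.le)

theorem ArcChain.isAverage_rotation {k : ℕ} (h : k ≤ N + 1) (hk : 2 ≤ k)
    (A : ArcChain γ s t) : IsAverage (grMeasure N k h) (rotation γ s t)
      fun p => rotation (sphereProj p ∘ γ) s t := by
  have key : ∀ {x y : ℝ}, IsArc γ x y → IsAverage (grMeasure N k h) (rotation γ x y)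
      fun p => rotation (sphereProj p ∘ γ) x y := fun {x y} A => by
    rw [A.rotation_eq_zero]
    refine IsAverage.congr (F := fun _ => 0)
      ⟨ENNReal.zero_ne_top, aemeasurable_const, by simp⟩ ?_
    filter_upwards [A.ae_proj h hk] with p hp using hp.2.rotation_eq_zero
  induction A with
  | arc A => exact key A
  | append A A' ih =>
    obtain ⟨_, _, B⟩ := A.exists_arc_left
    have hturn := isAverage_angle_leftTan_rightTan h hk B A' (Or.inl rfl) (one_smul ℝ _).symm
    simp only [one_smul] at hturn
    have := (ih.add hturn).add (key A')
    rw [← turningAngle_eq, ← rotation_add γ A.lt A'.lt] at this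
    exact this.congr (Filter.Eventually.of_forall fun p => rotation_add _ A.lt A'.lt)

theorem sphereProj_smul_of_eq {k : ℕ} (p : Gr N k) {σ : ℝ} (hσ : σ = 1 ∨ σ = -1) (x : Euc N) :
    sphereProj p (σ • x) = σ • sphereProj p x := by
  rcases hσ with rfl | rfl
  · simp
  · simp [sphereProj]

theorem ArcChain.isAverage_closedRotation {k : ℕ} (h : k ≤ N + 1) (hk : 2 ≤ k)
    (A : ArcChain γ a b) {σ : ℝ} (hσ : σ = 1 ∨ σ = -1) (hab : γ b = σ • γ a) :
    IsAverage (grMeasure N k h) (closedRotation γ a b)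
      fun p => closedRotation (sphereProj p ∘ γ) a b := by
  have hclosing : ∀ {η : ℝ → Euc N}, ‖η a‖ = 1 → η b = σ • η a →
      closingAngle η a b = angle (leftTan η b) (σ • rightTan η a) := fun {η} h1 h2 => by
    rw [closingAngle, h2, inner_smul_right, real_inner_self_eq_norm_sq, h1, one_pow, mul_one]
    rfl
  have ha : a ∈ Icc a b := left_mem_Icc.2 A.lt.le
  obtain ⟨_, _, B⟩ := A.exists_arc_left
  obtain ⟨_, _, B'⟩ := A.exists_arc_right
  have := (A.isAverage_rotation h hk).add
    (isAverage_angle_leftTan_rightTan h hk B B' hσ hab)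
  rw [← hclosing (A.norm_eq_one ha) hab] at this
  refine this.congr ?_
  filter_upwards [A.ae_proj h hk] with p hp
  rw [closedRotation, hclosing (hp.2.norm_eq_one ha)]
  simp only [Function.comp, hab, sphereProj_smul_of_eq p hσ]

end projection

/-! ### Polygonal curves are chains of arcs -/

section polygonal

variable {N : ℕ} {γ : ℝ → Euc N} {a b s t : ℝ}

/-- An arc may wrap around the circle many times, so it is cut into arcs shorter than `π`. The
parameter `x₀` is kept free so that the same formula serves on subintervals. -/
theorem arcChain_of_eq_circ {v w : Euc N} (hv : ‖v‖ = 1) (hw : ‖w‖ = 1) (hvw : ⟪v, w⟫ = 0)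
    {c x₀ : ℝ} (hc : 0 < c) (hst : s < t)
    (hγ : ∀ x ∈ Icc s t, γ x = circ v w (c * (x - x₀))) : ArcChain γ s t := by
  have single : ∀ {s t : ℝ}, s < t → c * (t - s) < Real.pi →
      (∀ x ∈ Icc s t, γ x = circ v w (c * (x - x₀))) → IsArc γ s t := by
    intro s t hst hlt hγ
    refine ⟨circ v w (c * (s - x₀)), circ v w (c * (s - x₀) + Real.pi / 2), fun x => c * (x - s),
      hst, norm_circ hv hw hvw _, norm_circ hv hw hvw _, ?_, by simp, hlt, fun x _ => ?_,
      fun x hx => ?_⟩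
    · rw [inner_circ_circ hv hw hvw, sub_add_cancel_left, Real.cos_neg, Real.cos_pi_div_two]
    · refine ⟨c, hc, ?_⟩
      simpa using (((hasDerivAt_id x).sub_const s).const_mul c).hasDerivWithinAt
    · rw [hγ x hx, circ_circ]
      congr 1
      ring
  have key : ∀ n : ℕ, ∀ t, s < t → c * (t - s) < n * (Real.pi / 2) →
      (∀ x ∈ Icc s t, γ x = circ v w (c * (x - x₀))) → ArcChain γ s t := by
    intro n
    induction n with
    | zero =>
      intro t hst hlt _
      have := mul_pos hc (sub_pos.2 hst)
      simp only [Nat.cast_zero, zero_mul] at hlt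
      linarith
    | succ n ih =>
      intro t hst hlt hγ
      by_cases hsmall : c * (t - s) < Real.pi
      · exact .arc (single hst hsmall hγ)
      · have hpi := Real.pi_pos
        -- A final quarter turn is cut off; as the total angle is at least `π`, a positive angle
        -- remains on the left.
        set m := t - Real.pi / 2 / c with hm
        have hcm : c * (t - m) = Real.pi / 2 := by rw [hm]; field_simp; ring
        have hmt : m < t := by
          have : 0 < Real.pi / 2 / c := by positivity
          linarith
        have hcs : c * (m - s) = c * (t - s) - Real.pi / 2 := by linarith
        have hsm : s < m := by
          have : 0 < c * (m - s) := by linarith [not_lt.1 hsmall]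
          exact sub_pos.1 (pos_of_mul_pos_right this hc.le)
        refine (ih m hsm ?_ fun x hx => hγ x ⟨hx.1, hx.2.trans hmt.le⟩).append
          (single hmt (by linarith) fun x hx => hγ x ⟨hsm.le.trans hx.1, hx.2⟩)
        push_cast at hlt
        linarith
  obtain ⟨n, hn⟩ := exists_nat_gt (c * (t - s) / (Real.pi / 2))
  exact key n t hst ((div_lt_iff₀ (by positivity)).1 hn) hγ

theorem IsSpherePolygonal.arcChain (h : IsSpherePolygonal γ a b) : ArcChain γ a b := by
  obtain ⟨hab, m, t, rfl, rfl, ht⟩ := h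
  have pieces : ∀ i < m, ArcChain γ (t i) (t (i + 1)) := fun i hi => by
    obtain ⟨hlt, v, w, c, hv, hw, hvw, hc, hγ⟩ := ht i hi
    exact arcChain_of_eq_circ hv hw hvw hc hlt hγ
  have key : ∀ i < m, ArcChain γ (t 0) (t (i + 1)) := by
    intro i hi
    induction i with
    | zero => exact pieces 0 hi
    | succ i ih => exact (ih (by omega)).trans (pieces (i + 1) hi)
  rcases m with _ | m
  · exact absurd hab (lt_irrefl _)
  · exact key m (by omega)

end polygonal

/-! ### Curves in the projective space -/

section projective

variable {N : ℕ} {γ : ℝ → RP N} {η : ℝ → Euc N} {a b s t : ℝ}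

theorem eq_or_eq_neg_of_mk_eq {x y : Euc N} (hx : x ≠ 0) (hy : y ≠ 0) (hx1 : ‖x‖ = 1)
    (hy1 : ‖y‖ = 1) (h : Projectivization.mk ℝ x hx = Projectivization.mk ℝ y hy) :
    ∃ σ : ℝ, (σ = 1 ∨ σ = -1) ∧ x = σ • y := by
  obtain ⟨σ, hσ⟩ := (Projectivization.mk_eq_mk_iff' ℝ x y hx hy).1 h
  refine ⟨σ, ?_, hσ.symm⟩
  have := congrArg norm hσ
  rw [norm_smul, hx1, hy1, mul_one] at this
  exact eq_or_eq_neg_of_abs_eq this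

theorem circ_smul_smul (v w : Euc N) (σ θ : ℝ) : circ (σ • v) (σ • w) θ = σ • circ v w θ := by
  simp only [circ]
  module

/-- The pieces are lifted one after the other; the sign of each new piece is chosen to match the
endpoint already reached. -/
theorem IsRPPolygonal.exists_lift (h : IsRPPolygonal γ a b) :
    ∃ η, ArcChain η a b ∧ IsLift γ η a b := by
  obtain ⟨hab, m, t, rfl, rfl, ht⟩ := h
  have key : ∀ i < m, ∃ η : ℝ → Euc N, ArcChain η (t 0) (t (i + 1)) ∧
      ∀ x ∈ Icc (t 0) (t (i + 1)), ∃ h : η x ≠ 0, Projectivization.mk ℝ (η x) h = γ x := by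
    intro i hi
    induction i with
    | zero =>
      obtain ⟨hlt, v, w, c, hv, hw, hvw, hc, hγ⟩ := ht 0 hi
      refine ⟨fun x => circ v w (c * (x - t 0)),
        arcChain_of_eq_circ hv hw hvw hc hlt fun _ _ => rfl, fun x hx => ?_⟩
      obtain ⟨h, h'⟩ := hγ x hx
      exact ⟨h, h'.symm⟩
    | succ i ih =>
      obtain ⟨η, hη, hηγ⟩ := ih (by omega)
      obtain ⟨hlt, v, w, c, hv, hw, hvw, hc, hγ⟩ := ht (i + 1) hi
      set r := t (i + 1)
      obtain ⟨hr, hr'⟩ := hηγ r (right_mem_Icc.2 hη.lt.le)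
      obtain ⟨hq, hq'⟩ := hγ r (left_mem_Icc.2 hlt.le)
      obtain ⟨σ, hσ, hσr⟩ := eq_or_eq_neg_of_mk_eq hr hq
        (hη.norm_eq_one (right_mem_Icc.2 hη.lt.le)) (norm_circ hv hw hvw _) (hr'.trans hq')
      have hσ1 : ‖σ‖ = 1 := by rcases hσ with rfl | rfl <;> simp
      have hσ0 : σ ≠ 0 := by rcases hσ with rfl | rfl <;> norm_num
      let η' : ℝ → Euc N := fun x => if x ≤ r then η x else σ • circ v w (c * (x - r))
      have h1 : ∀ x ≤ r, η' x = η x := fun x hx => if_pos hx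
      have h2 : ∀ x ∈ Icc r (t (i + 1 + 1)), η' x = σ • circ v w (c * (x - r)) := by
        intro x hx
        rcases hx.1.eq_or_lt with rfl | hx
        · rw [h1 _ le_rfl]; exact hσr
        · exact if_neg (not_le.2 hx)
      refine ⟨η', (hη.congr fun x hx => h1 x hx.2).trans ?_, fun x hx => ?_⟩
      · refine arcChain_of_eq_circ (v := σ • v) (w := σ • w) (c := c) (x₀ := r) ?_ ?_ ?_ hc hlt
          fun x hx => ?_
        · rw [norm_smul, hσ1, hv, mul_one]
        · rw [norm_smul, hσ1, hw, mul_one]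
        · rw [inner_smul_left, inner_smul_right, hvw, mul_zero, mul_zero]
        · rw [h2 x hx, circ_smul_smul]
      · rcases le_total x r with hxr | hxr
        · rw [h1 x hxr]
          exact hηγ x ⟨hx.1, hxr⟩
        · obtain ⟨h3, h4⟩ := hγ x ⟨hxr, hx.2⟩
          rw [h2 x ⟨hxr, hx.2⟩, h4]
          exact ⟨smul_ne_zero hσ0 h3,
            (Projectivization.mk_eq_mk_iff' ℝ _ _ (smul_ne_zero hσ0 h3) h3).2 ⟨σ, rfl⟩⟩
  rcases m with _ | m
  · exact absurd hab (lt_irrefl _)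
  · obtain ⟨η, hη, hηγ⟩ := key m (by omega)
    exact ⟨η, hη, hη.continuousOn, fun x hx => ⟨hη.norm_eq_one hx, hηγ x hx⟩⟩

/-- The inner product of the two lifts is continuous with values `1` and `-1` on an interval, hence
constant. -/
theorem IsLift.exists_eq_smul {η' : ℝ → Euc N} (hab : a ≤ b) (h : IsLift γ η a b)
    (h' : IsLift γ η' a b) : ∃ σ : ℝ, (σ = 1 ∨ σ = -1) ∧ ∀ x ∈ Icc a b, η' x = σ • η x := by
  have hsign : ∀ x ∈ Icc a b, ∃ σ : ℝ, (σ = 1 ∨ σ = -1) ∧ η' x = σ • η x := fun x hx => by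
    obtain ⟨h1, h2, h3⟩ := h.2 x hx
    obtain ⟨h1', h2', h3'⟩ := h'.2 x hx
    exact eq_or_eq_neg_of_mk_eq h2' h2 h1' h1 (h3'.trans h3.symm)
  have hinner : ∀ x ∈ Icc a b, ∀ σ : ℝ, η' x = σ • η x → ⟪η x, η' x⟫ = σ := fun x hx σ hσ => by
    rw [hσ, inner_smul_right, real_inner_self_eq_norm_sq, (h.2 x hx).1, one_pow, mul_one]
  have hmaps : MapsTo (fun x => ⟪η x, η' x⟫) (Icc a b) ({1, -1} : Set ℝ) := fun x hx => by
    obtain ⟨σ, hσ, hσx⟩ := hsign x hx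
    simp only [hinner x hx σ hσx]
    exact hσ
  have hfin : ({1, -1} : Set ℝ).Finite := by simp
  have hcont : ContinuousOn (fun x => ⟪η x, η' x⟫) (Icc a b) := h.1.inner h'.1
  have ha : a ∈ Icc a b := left_mem_Icc.2 hab
  obtain ⟨σ, hσ, hσa⟩ := hsign a ha
  refine ⟨σ, hσ, fun x hx => ?_⟩
  obtain ⟨σ', -, hσ'⟩ := hsign x hx
  have := isPreconnected_Icc.constant_of_mapsTo hfin.isDiscrete hcont hmaps hx ha
  simp only [hinner x hx _ hσ', hinner a ha _ hσa] at this
  rw [hσ', this]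

theorem rotation_smul_eq {η' : ℝ → Euc N} {σ : ℝ} (hσ : σ ≠ 0)
    (h : ∀ x ∈ Icc a b, η' x = σ • η x) : rotation η' a b = rotation η a b := by
  refine tsum_congr fun x => ?_
  have hnhds : η' =ᶠ[nhds (x : ℝ)] σ • η := by
    filter_upwards [Icc_mem_nhds x.2.1 x.2.2] with y hy using h y hy
  rw [turningAngle, turningAngle, (hnhds.filter_mono nhdsWithin_le_nhds).derivWithin_eq
    hnhds.eq_of_nhds, (hnhds.filter_mono nhdsWithin_le_nhds).derivWithin_eq hnhds.eq_of_nhds,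
    derivWithin_const_smul_field, derivWithin_const_smul_field, angle_smul_smul hσ]

theorem closedRotation_smul_eq {η' : ℝ → Euc N} {σ : ℝ} (hab : a < b) (hσ : σ = 1 ∨ σ = -1)
    (h : ∀ x ∈ Icc a b, η' x = σ • η x) : closedRotation η' a b = closedRotation η a b := by
  have hσ0 : σ ≠ 0 := by rcases hσ with rfl | rfl <;> norm_num
  have hσσ : σ * σ = 1 := by rcases hσ with rfl | rfl <;> norm_num
  have ha : a ∈ Icc a b := left_mem_Icc.2 hab.le
  have hb : b ∈ Icc a b := right_mem_Icc.2 hab.le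
  have h1 : η' =ᶠ[nhdsWithin b (Iic b)] σ • η := by
    filter_upwards [Icc_mem_nhdsLE hab] with y hy using h y hy
  have h2 : η' =ᶠ[nhdsWithin a (Ici a)] σ • η := by
    filter_upwards [Icc_mem_nhdsGE hab] with y hy using h y hy
  have hin : ⟪η' a, η' b⟫ = ⟪η a, η b⟫ := by
    rw [h a ha, h b hb, inner_smul_left, inner_smul_right, ← mul_assoc, conj_trivial, hσσ, one_mul]
  rw [closedRotation, closedRotation, rotation_smul_eq hσ0 h, closingAngle, closingAngle,
    h1.derivWithin_eq (h b hb), h2.derivWithin_eq (h a ha), derivWithin_const_smul_field,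
    derivWithin_const_smul_field, hin, smul_comm, angle_smul_smul hσ0]

/-- All lifts have the same rotation, so the infimum is the value at any one of them. -/
theorem IsLift.rpRotation_eq (hab : a ≤ b) (h : IsLift γ η a b) :
    rpRotation γ a b = rotation η a b := by
  refine le_antisymm (iInf₂_le η h) (le_iInf₂ fun η' h' => ?_)
  obtain ⟨σ, hσ, hσ'⟩ := h.exists_eq_smul hab h'
  exact (rotation_smul_eq (by rcases hσ with rfl | rfl <;> norm_num) hσ').ge

theorem IsLift.rpClosedRotation_eq (hab : a < b) (h : IsLift γ η a b) :
    rpClosedRotation γ a b = closedRotation η a b := by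
  refine le_antisymm (iInf₂_le η h) (le_iInf₂ fun η' h' => ?_)
  obtain ⟨σ, hσ, hσ'⟩ := h.exists_eq_smul hab.le h'
  exact (closedRotation_smul_eq hab hσ hσ').ge

theorem exists_smul_eq_rep {x : RP N} {y : Euc N} (h : ∃ h : y ≠ 0, Projectivization.mk ℝ y h = x) :
    ∃ c : ℝ, c ≠ 0 ∧ x.rep = c • y := by
  obtain ⟨hy, rfl⟩ := h
  obtain ⟨c, hc⟩ := Projectivization.exists_smul_eq_mk_rep ℝ y hy
  exact ⟨c, c.ne_zero, hc.symm⟩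

/-- A negative change of representative replaces the angle by its supplement, which only permutes
the two terms of the minimum. -/
theorem rpDist_eq {x y : RP N} {x' y' : Euc N}
    (hx : ∃ h : x' ≠ 0, Projectivization.mk ℝ x' h = x)
    (hy : ∃ h : y' ≠ 0, Projectivization.mk ℝ y' h = y) :
    rpDist x y = min (angle x' y') (Real.pi - angle x' y') := by
  obtain ⟨c, hc, hcx⟩ := exists_smul_eq_rep hx
  obtain ⟨d, hd, hdy⟩ := exists_smul_eq_rep hy
  rw [rpDist, angle_neg_right, hcx, hdy]
  rcases lt_or_gt_of_ne hc with hc | hc <;> rcases lt_or_gt_of_ne hd with hd | hd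
  · rw [angle_smul_left_of_neg _ _ hc, angle_smul_right_of_neg _ _ hd, angle_neg_neg]
  · rw [angle_smul_left_of_neg _ _ hc, angle_smul_right_of_pos _ _ hd, angle_neg_left, min_comm,
      sub_sub_cancel]
  · rw [angle_smul_left_of_pos _ _ hc, angle_smul_right_of_neg _ _ hd, angle_neg_right, min_comm,
      sub_sub_cancel]
  · rw [angle_smul_left_of_pos _ _ hc, angle_smul_right_of_pos _ _ hd]

/-- The halves have angle at most `π / 2`, where the projective distance agrees with the angle in
the lift. -/
theorem IsArc.exists_midpoint (A : IsArc η s t) : ∃ m ∈ Icc s t,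
    angle (η s) (η m) = angle (η s) (η t) / 2 ∧ angle (η m) (η t) = angle (η s) (η t) / 2 := by
  obtain ⟨v, w, φ, A⟩ := A
  have hpos := A.strictMonoOn.monotoneOn A.left_mem A.right_mem A.lt.le
  have h0 := A.zero
  obtain ⟨m, hm, hm'⟩ := intermediate_value_Icc A.lt.le A.continuousOn_angle
    (show φ t / 2 ∈ Icc (φ s) (φ t) from ⟨by linarith, by linarith⟩)
  refine ⟨m, hm, ?_, ?_⟩
  · rw [A.angle_eq le_rfl hm.1 hm.2, A.angle_eq le_rfl A.lt.le le_rfl]; linarith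
  · rw [A.angle_eq hm.1 hm.2 le_rfl, A.angle_eq le_rfl A.lt.le le_rfl]; linarith

/-- Projective distances never exceed angles in the lift, which gives one inequality. For the other,
each arc is halved so that the two distances coincide. -/
theorem ArcChain.rpLength_eq (A : ArcChain η a b) (h : IsLift γ η a b) :
    rpLength γ a b = sphereLength η a b := by
  have hrep : ∀ x ∈ Icc a b, ∃ h : η x ≠ 0, Projectivization.mk ℝ (η x) h = γ x := fun x hx =>
    (h.2 x hx).2
  refine le_antisymm (curveLength_le fun n u hu hum => ?_) ?_
  · refine le_trans (Finset.sum_le_sum fun i _ => ?_) (sum_le_curveLength n hu hum)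
    refine ENNReal.ofReal_le_ofReal ?_
    rw [rpDist_eq (hrep _ (hum _)) (hrep _ (hum _))]
    exact min_le_left _ _
  · have arcs : ∀ {s t : ℝ}, IsArc η s t →
        (∀ x ∈ Icc s t, ∃ h : η x ≠ 0, Projectivization.mk ℝ (η x) h = γ x) →
        sphereLength η s t ≤ rpLength γ s t := by
      intro s t A hrep
      obtain ⟨m, hm, h1, h2⟩ := A.exists_midpoint
      have hpi := angle_le_pi (η s) (η t)
      have hs := hrep s (left_mem_Icc.2 A.lt.le)
      have ht := hrep t (right_mem_Icc.2 A.lt.le)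
      have d1 : rpDist (γ s) (γ m) = angle (η s) (η t) / 2 := by
        rw [rpDist_eq hs (hrep m hm), h1]
        exact min_eq_left (by linarith)
      have d2 : rpDist (γ m) (γ t) = angle (η s) (η t) / 2 := by
        rw [rpDist_eq (hrep m hm) ht, h2]
        exact min_eq_left (by linarith)
      rw [A.sphereLength_eq]
      refine le_trans (le_of_eq ?_) ((add_le_add (ofReal_dist_le_curveLength hm.1)
        (ofReal_dist_le_curveLength hm.2)).trans (curveLength_add_le hm.1 hm.2))
      rw [d1, d2, ← ENNReal.ofReal_add (by linarith [angle_nonneg (η s) (η t)])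
        (by linarith [angle_nonneg (η s) (η t)]), add_halves]
    clear h
    induction A with
    | arc A => exact arcs A hrep
    | append A A' ih =>
      rw [sphereLength_add A.lt.le A'.lt.le]
      exact (add_le_add (ih fun x hx => hrep x ⟨hx.1, hx.2.trans A'.lt.le⟩)
        (arcs A' fun x hx => hrep x ⟨A.lt.le.trans hx.1, hx.2⟩)).trans
        (curveLength_add_le A.lt.le A'.lt.le)

theorem proj_rep_ne_zero {k : ℕ} {p : Gr N k} {x : RP N} {y : Euc N}
    (h : ∃ h : y ≠ 0, Projectivization.mk ℝ y h = x) (hp : p.proj y ≠ 0) : p.proj x.rep ≠ 0 := by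
  obtain ⟨c, hc, hcx⟩ := exists_smul_eq_rep h
  rw [hcx, map_smul]
  exact smul_ne_zero hc hp

theorem IsLift.proj {k : ℕ} {p : Gr N k} (h : IsLift γ η a b)
    (hp : ∀ x ∈ Icc a b, p.proj (η x) ≠ 0) :
    IsLift (rpProj p ∘ γ) (sphereProj p ∘ η) a b := by
  refine ⟨?_, fun x hx => ⟨norm_smul_inv_norm (hp x hx), ?_⟩⟩
  · have : ContinuousOn (fun x => p.proj (η x)) (Icc a b) :=
      p.proj.continuous.comp_continuousOn h.1
    exact (this.norm.inv₀ fun x hx => norm_ne_zero_iff.2 (hp x hx)).smul this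
  · have hrep := (h.2 x hx).2
    have h0 := proj_rep_ne_zero hrep (hp x hx)
    have h1 : (sphereProj p ∘ η) x ≠ 0 :=
      smul_ne_zero (inv_ne_zero (norm_ne_zero_iff.2 (hp x hx))) (hp x hx)
    obtain ⟨c, hc, hcx⟩ := exists_smul_eq_rep hrep
    refine ⟨h1, ?_⟩
    simp only [Function.comp, rpProj]
    rw [dif_pos h0, Projectivization.mk_eq_mk_iff' ℝ]
    refine ⟨‖p.proj (η x)‖⁻¹ * c⁻¹, ?_⟩
    rw [hcx, map_smul, smul_smul, mul_assoc, inv_mul_cancel₀ hc, mul_one]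
    rfl

end projective

/-! ### The averages of length, rotation and total curvature -/

section averages

variable {N k : ℕ} {a b : ℝ}

theorem ArcChain.average {γ : ℝ → Euc N} (h : k ≤ N + 1) (hk : 2 ≤ k) (A : ArcChain γ a b) :
    IsAverage (grMeasure N k h) (totalCurvature γ a b)
      (fun p => totalCurvature (sphereProj p ∘ γ) a b) ∧
    (γ a = γ b →
      IsAverage (grMeasure N k h) (closedRotation γ a b)
        (fun p => closedRotation (sphereProj p ∘ γ) a b) ∧
      IsAverage (grMeasure N k h) (closedTotalCurvature γ a b)
        (fun p => closedTotalCurvature (sphereProj p ∘ γ) a b)) := by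
  refine ⟨?_, fun hab => ?_⟩
  · rw [A.totalCurvature_eq]
    refine ((A.isAverage_sphereLength h hk).add (A.isAverage_rotation h hk)).congr ?_
    filter_upwards [A.ae_proj h hk] with p hp using hp.2.totalCurvature_eq
  · have hrot := A.isAverage_closedRotation h hk (Or.inl rfl) (σ := 1) (by rw [one_smul, hab])
    refine ⟨hrot, ?_⟩
    rw [A.closedTotalCurvature_eq hab]
    refine ((A.isAverage_sphereLength h hk).add hrot).congr ?_
    filter_upwards [A.ae_proj h hk] with p hp
    exact hp.2.closedTotalCurvature_eq (congrArg (sphereProj p) hab)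

theorem IsRPPolygonal.average {γ : ℝ → RP N} (h : k ≤ N + 1) (hk : 2 ≤ k)
    (hγ : IsRPPolygonal γ a b) :
    (∀ᵐ p ∂grMeasure N k h, ∀ s ∈ Icc a b, p.proj (γ s).rep ≠ 0) ∧
    IsAverage (grMeasure N k h) (rpLength γ a b) (fun p => rpLength (rpProj p ∘ γ) a b) ∧
    IsAverage (grMeasure N k h) (rpRotation γ a b) (fun p => rpRotation (rpProj p ∘ γ) a b) ∧
    IsAverage (grMeasure N k h) (rpTotalCurvature γ a b)
      (fun p => rpTotalCurvature (rpProj p ∘ γ) a b) ∧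
    (γ a = γ b →
      IsAverage (grMeasure N k h) (rpClosedRotation γ a b)
        (fun p => rpClosedRotation (rpProj p ∘ γ) a b) ∧
      IsAverage (grMeasure N k h) (rpClosedTotalCurvature γ a b)
        (fun p => rpClosedTotalCurvature (rpProj p ∘ γ) a b)) := by
  obtain ⟨η, A, hη⟩ := hγ.exists_lift
  have hlen : IsAverage (grMeasure N k h) (rpLength γ a b)
      (fun p => rpLength (rpProj p ∘ γ) a b) := by
    rw [A.rpLength_eq hη]
    refine (A.isAverage_sphereLength h hk).congr ?_
    filter_upwards [A.ae_proj h hk] with p hp using hp.2.rpLength_eq (hη.proj hp.1)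
  have hrot : IsAverage (grMeasure N k h) (rpRotation γ a b)
      (fun p => rpRotation (rpProj p ∘ γ) a b) := by
    rw [hη.rpRotation_eq A.lt.le]
    refine (A.isAverage_rotation h hk).congr ?_
    filter_upwards [A.ae_proj h hk] with p hp using (hη.proj hp.1).rpRotation_eq A.lt.le
  refine ⟨?_, hlen, hrot, hlen.add hrot, fun hab => ?_⟩
  · filter_upwards [A.ae_proj h hk] with p hp
    exact fun s hs => proj_rep_ne_zero (hη.2 s hs).2 (hp.1 s hs)
  · obtain ⟨ha, ha0, ha'⟩ := hη.2 a (left_mem_Icc.2 A.lt.le)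
    obtain ⟨hb, hb0, hb'⟩ := hη.2 b (right_mem_Icc.2 A.lt.le)
    -- `σ` is the sign with which the lift closes up.
    obtain ⟨σ, hσ, hσb⟩ := eq_or_eq_neg_of_mk_eq hb0 ha0 hb ha
      (by rw [hb', ha', hab])
    have hclosed : IsAverage (grMeasure N k h) (rpClosedRotation γ a b)
        (fun p => rpClosedRotation (rpProj p ∘ γ) a b) := by
      rw [hη.rpClosedRotation_eq A.lt]
      refine (A.isAverage_closedRotation h hk hσ hσb).congr ?_
      filter_upwards [A.ae_proj h hk] with p hp using (hη.proj hp.1).rpClosedRotation_eq A.lt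
    exact ⟨hclosed, hlen.add hclosed⟩

end averages

end PolyAvg
end

theorem theorem3p2 (N j : ℕ) (hj : 1 ≤ j) (hjN : j + 1 ≤ N) (a b : ℝ) :
    -- polygonal curves in the sphere
    (∀ γ : ℝ → PolyAvg.Euc N, PolyAvg.IsSpherePolygonal γ a b →
      (∀ᵐ p ∂(PolyAvg.grMeasure N (j + 1) (by omega)), ∀ s ∈ Set.Icc a b, p.proj (γ s) ≠ 0) ∧
      PolyAvg.IsAverage (PolyAvg.grMeasure N (j + 1) (by omega)) (PolyAvg.sphereLength γ a b)
        (fun p => PolyAvg.sphereLength (PolyAvg.sphereProj p ∘ γ) a b) ∧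
      PolyAvg.IsAverage (PolyAvg.grMeasure N (j + 1) (by omega)) (PolyAvg.rotation γ a b)
        (fun p => PolyAvg.rotation (PolyAvg.sphereProj p ∘ γ) a b) ∧
      PolyAvg.IsAverage (PolyAvg.grMeasure N (j + 1) (by omega)) (PolyAvg.totalCurvature γ a b)
        (fun p => PolyAvg.totalCurvature (PolyAvg.sphereProj p ∘ γ) a b) ∧
      (γ a = γ b →
        PolyAvg.IsAverage (PolyAvg.grMeasure N (j + 1) (by omega)) (PolyAvg.closedRotation γ a b)
          (fun p => PolyAvg.closedRotation (PolyAvg.sphereProj p ∘ γ) a b) ∧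
        PolyAvg.IsAverage (PolyAvg.grMeasure N (j + 1) (by omega))
          (PolyAvg.closedTotalCurvature γ a b)
          (fun p => PolyAvg.closedTotalCurvature (PolyAvg.sphereProj p ∘ γ) a b))) ∧
    -- polygonal curves in the projective space
    (∀ γ : ℝ → PolyAvg.RP N, PolyAvg.IsRPPolygonal γ a b →
      (∀ᵐ p ∂(PolyAvg.grMeasure N (j + 1) (by omega)), ∀ s ∈ Set.Icc a b, p.proj (γ s).rep ≠ 0) ∧
      PolyAvg.IsAverage (PolyAvg.grMeasure N (j + 1) (by omega)) (PolyAvg.rpLength γ a b)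
        (fun p => PolyAvg.rpLength (PolyAvg.rpProj p ∘ γ) a b) ∧
      PolyAvg.IsAverage (PolyAvg.grMeasure N (j + 1) (by omega)) (PolyAvg.rpRotation γ a b)
        (fun p => PolyAvg.rpRotation (PolyAvg.rpProj p ∘ γ) a b) ∧
      PolyAvg.IsAverage (PolyAvg.grMeasure N (j + 1) (by omega)) (PolyAvg.rpTotalCurvature γ a b)
        (fun p => PolyAvg.rpTotalCurvature (PolyAvg.rpProj p ∘ γ) a b) ∧
      (γ a = γ b →
        PolyAvg.IsAverage (PolyAvg.grMeasure N (j + 1) (by omega)) (PolyAvg.rpClosedRotation γ a b)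
          (fun p => PolyAvg.rpClosedRotation (PolyAvg.rpProj p ∘ γ) a b) ∧
        PolyAvg.IsAverage (PolyAvg.grMeasure N (j + 1) (by omega))
          (PolyAvg.rpClosedTotalCurvature γ a b)
          (fun p => PolyAvg.rpClosedTotalCurvature (PolyAvg.rpProj p ∘ γ) a b))) := by
  refine ⟨fun γ hγ => ?_, fun γ hγ => hγ.average _ (by omega)⟩
  have A := hγ.arcChain
  have h := A.average (k := j + 1) (by omega) (by omega)
  refine ⟨?_, A.isAverage_sphereLength _ (by omega), A.isAverage_rotation _ (by omega), h.1, h.2⟩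
  filter_upwards [A.ae_proj (k := j + 1) (by omega) (by omega)] with p hp using hp.1
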